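/- A network is a finite non-empty undirected graph $G=(V,E)$; its vertices are the agents. The agents $v\in V$ arrive at independent times $t_v$, uniformly distributed on $[0,1]$, with $T=(t_v)_{v\in V}$. The state $\theta\in\{0,1\}$ is uniformly distributed and independent of $T$. Given $\theta$ and $T$, the signals $s_v\in\{0,1\}$, $v\in V$, are independent, and each equals $\theta$ with probability $p$, where $\frac12<p\le 1$. Upon arrival, agent $v$ knows his signal $s_v$, the set $F_{v,T}=\{u\in V: uv\in E,\ t_u<t_v\}$ of his friends who arrived earlier, and their actions $(a_u)_{u\in F_{v,T}}$, and nothing else. He then draws an action $a_v\in\{0,1\}$ from the distribution $\sigma_v\big(s_v,F_{v,T},(a_u)_{u\in F_{v,T}}\big)$, where $\sigma_v$ is his mixed strategy. Let $\mathbb P_\sigma$ be the resulting law of $\big(T,\theta,(s_v)_{v\in V},(a_v)_{v\in V}\big)$ under the profile $\sigma=(\sigma_v)_{v\in V}$. The learning quality of $v$ is $l_\sigma(v)=\mathbb P_\sigma(a_v=\theta)$. The profile $\sigma$ is an equilibrium if no agent $v$ can increase $l_\sigma(v)$ by changing only his own strategy. It is state-symmetric if $\mathbb P_\sigma$ is invariant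 under $(T,\theta,s,a)\mapsto\big(T,1-\theta,(1-s_v)_{v\in V},(1-a_v)_{v\in V}\big)$. The network $G$ is symmetric if for all $v,v'\in V$ there is an automorphism $f$ of $G$ with $f(v)=v'$. Then the following holds. For any $p_0>\frac12$ and any $\delta>0$ there exists a symmetric network $G=(V,E)$ such that $l_\sigma(v)\ge 1-\delta$ for each agent $v\in V$, any probability of the correct signal $p\in(p_0,1]$, and any state-symmetric equilibrium $\sigma$ of the game on $G$ with signal precision $p$. -/

import Mathlib

open MeasureTheory

/-!
Sequential social learning on a network with random arrival times. The two states, the two signals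
and the two actions `0, 1` are the two elements of `Bool`; `!b` is `1 - b`.
-/

namespace SocialLearning

noncomputable section

/-- A network is symmetric if its automorphism group acts transitively on the vertices. -/
def IsSymmetricNetwork {V : Type*} (G : SimpleGraph V) : Prop :=
  ∀ v v' : V, ∃ f : G ≃g G, f v = v'

/-- The information `I_v = (s_v, F_{v,T}, (a_u)_{u ∈ F_{v,T}})` of an agent: his own signal, and the
partial function `u ↦ a_u` with domain `F_{v,T}`, the set of his friends who arrived before him
(the value is `none` outside `F_{v,T}`). -/
abbrev Info (V : Type*) : Type _ := Bool × (V → Option Bool)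

/-- A mixed strategy maps the information of an agent to a probability distribution on the
actions. -/
abbrev Strategy (V : Type*) : Type _ := Info V → PMF Bool

/-- A full description `(T, θ, s, a)` of what happens: arrival times in `[0, 1]`, the state, the
signals and the actions. -/
abbrev Outcome (V : Type*) : Type _ := (V → unitInterval) × Bool × (V → Bool) × (V → Bool)

open Classical in
/-- The information of the agent `v` when the arrival times are `T`, the signals are `s` and the
actions are `a`; `v` sees `a u` exactly when `u` is a friend with `T u < T v`. -/
def info {V : Type*} (G : SimpleGraph V) (v : V) (T : V → unitInterval) (s a : V → Bool) :
    Info V :=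
  (s v, fun u => if G.Adj v u ∧ T u < T v then some (a u) else none)

/-- The probability of the signal `b` in the state `θ` when signals have precision `p`. -/
def signalProb (p : ℝ) (θ b : Bool) : ENNReal :=
  if b = θ then ENNReal.ofReal p else ENNReal.ofReal (1 - p)

/-- The conditional probability of state `θ`, signals `s` and actions `a` given the arrival times
`T`: the state is a fair coin, the signals are independent given the state, and each agent, upon
arrival, draws his action from his strategy evaluated at his information (the chain rule along the
order of arrivals). -/
def density {V : Type*} [Fintype V] (G : SimpleGraph V) (p : ℝ) (σ : V → Strategy V)
    (ω : Outcome V) : ENNReal :=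
  match ω with
  | (T, θ, s, a) =>
    2⁻¹ * (∏ v, signalProb p θ (s v)) * ∏ v, σ v (info G v T s a) (a v)

/-- The law `ℙ_σ` of `(T, θ, s, a)` under the strategy profile `σ`. The reference measure is the
product of the uniform distribution on `[0, 1]^V` (independent uniform arrival times) and of the
counting measure on the finite set of triples `(θ, s, a)`. -/
def law {V : Type*} [Fintype V] (G : SimpleGraph V) (p : ℝ) (σ : V → Strategy V) :
    Measure (Outcome V) :=
  ((volume : Measure (V → unitInterval)).prod Measure.count).withDensity (density G p σ)

/-- The learning quality `l_σ(v) = ℙ_σ(a_v = θ)`. It is also the expected payoff of `v`. -/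
def learningQuality {V : Type*} [Fintype V] (G : SimpleGraph V) (p : ℝ) (σ : V → Strategy V)
    (v : V) : ℝ :=
  (law G p σ).real {ω | ω.2.2.2 v = ω.2.1}

open Classical in
/-- `σ` is a (Bayes–Nash) equilibrium: no agent can increase the probability that his action matches
the state by a unilateral change of strategy. -/
def IsEquilibrium {V : Type*} [Fintype V] (G : SimpleGraph V) (p : ℝ) (σ : V → Strategy V) : Prop :=
  ∀ (v : V) (τ : Strategy V),
    learningQuality G p (Function.update σ v τ) v ≤ learningQuality G p σ v

/-- Simultaneous flipping of the state, of all signals and of all actions. -/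
def flip {V : Type*} (ω : Outcome V) : Outcome V :=
  match ω with
  | (T, θ, s, a) => (T, !θ, fun v => !(s v), fun v => !(a v))

/-- The distribution `ℙ_σ` is invariant under simultaneous flipping of the state, signals and
actions. -/
def IsStateSymmetric {V : Type*} [Fintype V] (G : SimpleGraph V) (p : ℝ) (σ : V → Strategy V) :
    Prop :=
  MeasurePreserving flip (law G p σ) (law G p σ)

end

end SocialLearning

set_option linter.unusedSectionVars false

/-! The network must be symmetric, have large degree `D`, and give each agent neighbours whose
actions are nearly independent. `wordGraph D r` is a Cayley graph (possibly disconnected) of the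
permutations of the ball of radius `r` in the `D`-regular tree, generated by the `D` edge-crossing
involutions; hence it is vertex-transitive, and the action on the ball shows that it looks like a
tree around each vertex `v`. Information reaches `v` only along walks with decreasing arrival times,
and some such walk of length `r` exists with probability at most `D ^ r / (r + 1)!`, which tends to
0 for fixed `D`. Off this event, what `v` sees has the same law as in `branchGraph v`
(`condMean_wordGraph_eq`), where the neighbours of `v` lie in disjoint sets without edges between
them, so that they are independent given the state.

The neighbours must also be better than chance in each state. Deviating to one's own signal,
together with state symmetry, shows that an agent `u` is correct with probability at least `p` in
each state, for every set of earlier friends that he may see (`IsEquilibrium.integral_mul_correct`).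
However, `v` needs this on the event that `u` arrives before a given time `t`, and `u` does not know
his arrival time. The fraction of his friends already present estimates it up to order `1 / √D`, so
weighting by a Lipschitz function of that fraction almost conditions on the arrival time
(`integral_before_ge`). A factor `1 / (1 - x)` in the weight undoes the bias from requiring that `v`
arrive after `u`.

The total score of the earlier neighbours then has mean at least `D * m` and variance at most `D`.
By Chebyshev's inequality (`integral_totalScore_nonpos_le`) their majority is rarely wrong, and in
equilibrium `v` does at least as well as by following it. The bounds use `p` only through `2 * p -
1`, so they are uniform in `p > p₀`. -/

namespace SocialLearning

/-! ### Finite products of conditional kernels: marginals and independence. -/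

section CausalKernels

variable {V Z ι : Type*} [Fintype V] [DecidableEq V] [Fintype Z] [LinearOrder ι]

/-- `f` only depends on the coordinates in `C`. -/
def DependsOnlyOn {V Z β : Type*} (C : Finset V) (f : (V → Z) → β) : Prop :=
  ∀ z z' : V → Z, (∀ w ∈ C, z w = z' w) → f z = f z'

/-- `K w z` is the conditional probability of the coordinate `z w` given the coordinates that come
earlier in the order induced by `T`. -/
structure IsCausal (T : V → ι) (K : V → (V → Z) → ℝ) : Prop where
  congr : ∀ w z z', z w = z' w → (∀ w', T w' < T w → z w' = z' w') → K w z = K w z'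
  sum_update : ∀ w z, ∑ x, K w (Function.update z w x) = 1

theorem card_mul_sum_eq_sum_update (w : V) (F : (V → Z) → ℝ) :
    (Fintype.card Z : ℝ) * ∑ z, F z = ∑ z, ∑ x, F (Function.update z w x) := by
  have h : ∑ q : (V → Z) × Z, F (Function.update q.1 w q.2) = ∑ q : (V → Z) × Z, F q.1 := by
    refine Finset.sum_nbij' (fun q => (Function.update q.1 w q.2, q.1 w))
      (fun q => (Function.update q.1 w q.2, q.1 w)) ?_ ?_ ?_ ?_ ?_ <;> simp
  rw [← Fintype.sum_prod_type', h, Fintype.sum_prod_type]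
  simp [Finset.mul_sum]

/-- The latest agent of `R` is seen by no other agent of `R`, so summing over his coordinate removes
his kernel; this is iterated. The powers of `card Z` appear because the sums keep running over all
coordinates, including those already integrated out. -/
theorem IsCausal.sum_mul_prod {T : V → ι} {K : V → (V → Z) → ℝ} (hK : IsCausal T K)
    (R : Finset V) : ∀ f : (V → Z) → ℝ, (∀ z z', (∀ w, w ∉ R → z w = z' w) → f z = f z') →
      (Fintype.card Z : ℝ) ^ R.card * ∑ z, f z * ∏ w ∈ R, K w z = ∑ z, f z := by
  induction R using Finset.induction_on_max_value T with
  | empty => intro f _; simp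
  | insert a s has hmax ih =>
    intro f hf
    rw [Finset.card_insert_of_notMem has, pow_succ, mul_assoc, card_mul_sum_eq_sum_update a]
    have key : ∀ z : V → Z, ∑ x, f (Function.update z a x) *
        ∏ w ∈ insert a s, K w (Function.update z a x) = f z * ∏ w ∈ s, K w z := by
      intro z
      have h1 : ∀ x, f (Function.update z a x) = f z := fun x => hf _ _ fun w hw => by
        rw [Function.update_of_ne]; rintro rfl; simp at hw
      have h2 : ∀ x, ∏ w ∈ s, K w (Function.update z a x) = ∏ w ∈ s, K w z := fun x =>
        Finset.prod_congr rfl fun w hw => hK.congr _ _ _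
          (Function.update_of_ne (ne_of_mem_of_not_mem hw has) _ _) fun w' hw' =>
            Function.update_of_ne (by rintro rfl; exact absurd hw' (hmax w hw).not_gt) _ _
      simp_rw [Finset.prod_insert has, h1, h2]
      rw [← Finset.mul_sum, ← Finset.sum_mul, hK.sum_update, one_mul]
    simp_rw [key]
    refine ih f fun z z' h => hf z z' fun w hw => h w fun hws => hw (Finset.mem_insert_of_mem hws)

/-- The marginal law on a closed set of coordinates only depends on the kernels of this set. -/
theorem IsCausal.sum_prod_mul_congr {T₁ T₂ : V → ι} {K₁ K₂ : V → (V → Z) → ℝ} [Nonempty Z]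
    (h₁ : IsCausal T₁ K₁) (h₂ : IsCausal T₂ K₂) (C : Finset V) {f : (V → Z) → ℝ}
    (hf : DependsOnlyOn C f) (hC : ∀ w ∈ C, DependsOnlyOn C (K₁ w))
    (heq : ∀ w ∈ C, ∀ z, K₁ w z = K₂ w z) :
    ∑ z, (∏ w, K₁ w z) * f z = ∑ z, (∏ w, K₂ w z) * f z := by
  have hZ : (Fintype.card Z : ℝ) ^ Cᶜ.card ≠ 0 := by positivity
  apply mul_left_cancel₀ hZ
  have aux : ∀ (K : V → (V → Z) → ℝ) (z : V → Z), (∏ w, K w z) * f z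
      = (f z * ∏ w ∈ C, K w z) * ∏ w ∈ Cᶜ, K w z := fun K z => by
    rw [← Finset.prod_mul_prod_compl C]; ring
  simp_rw [aux]
  have hdep : ∀ z z' : V → Z, (∀ w, w ∉ Cᶜ → z w = z' w) →
      f z * ∏ w ∈ C, K₁ w z = f z' * ∏ w ∈ C, K₁ w z' := fun z z' h => by
    have h' : ∀ w ∈ C, z w = z' w := fun w hw => h w (by simpa using hw)
    rw [hf z z' h', Finset.prod_congr rfl fun w hw => hC w hw z z' h']
  have e : ∀ z, f z * ∏ w ∈ C, K₁ w z = f z * ∏ w ∈ C, K₂ w z := fun z => by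
    rw [Finset.prod_congr rfl fun w hw => heq w hw z]
  rw [h₁.sum_mul_prod Cᶜ _ hdep]
  simp_rw [e] at hdep ⊢
  rw [h₂.sum_mul_prod Cᶜ _ hdep]

theorem IsCausal.sum_prod {T : V → ι} {K : V → (V → Z) → ℝ} [Nonempty Z] (hK : IsCausal T K) :
    ∑ z, ∏ w, K w z = 1 := by
  have h := hK.sum_mul_prod Finset.univ (fun _ => 1) (by simp)
  simp only [one_mul, Finset.sum_const, nsmul_eq_mul, mul_one, Finset.card_univ,
    Fintype.card_fun, Nat.cast_pow] at h
  have hZ : (Fintype.card Z : ℝ) ^ Fintype.card V ≠ 0 := by positivity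
  exact mul_left_cancel₀ hZ (by rw [h, mul_one])

/-- Functions of the two sides of a decoupled set of coordinates are independent. -/
theorem IsCausal.sum_prod_mul_mul {T : V → ι} {K : V → (V → Z) → ℝ} [Nonempty Z]
    (hK : IsCausal T K) (C D : Finset V) (hCD : ∀ w, w ∈ D ↔ w ∉ C) {f g : (V → Z) → ℝ}
    (hf : DependsOnlyOn C f) (hg : DependsOnlyOn D g)
    (hC : ∀ w ∈ C, DependsOnlyOn C (K w)) (hD : ∀ w ∈ D, DependsOnlyOn D (K w)) :
    ∑ z, (∏ w, K w z) * (f z * g z) =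
      (∑ z, (∏ w, K w z) * f z) * ∑ z, (∏ w, K w z) * g z := by
  have hD' : D = Cᶜ := by ext w; simp [hCD]
  subst hD'
  -- Take two independent copies and exchange their coordinates outside `C`. All kernels respect the
  -- splitting, so the joint weight is unchanged, while `f` and `g` come to be evaluated on the same
  -- copy.
  have hswap : ∑ q : (V → Z) × (V → Z), ((∏ w, K w q.1) * f q.1) * ((∏ w, K w q.2) * g q.2) =
      ∑ q : (V → Z) × (V → Z), ((∏ w, K w q.1) * (f q.1 * g q.1)) * ∏ w, K w q.2 := by
    refine Finset.sum_nbij' (fun q => (C.piecewise q.1 q.2, C.piecewise q.2 q.1))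
      (fun q => (C.piecewise q.1 q.2, C.piecewise q.2 q.1)) (by simp) (by simp)
      ?_ ?_ ?_
    rotate_left 2
    · rintro ⟨z, z'⟩ -
      have hin : ∀ z z' : V → Z, ∀ w ∈ C, z w = C.piecewise z z' w := fun z z' w hw => by simp [hw]
      have hout : ∀ z z' : V → Z, ∀ w ∈ Cᶜ, z' w = C.piecewise z z' w := fun z z' w hw => by
        simp [Finset.mem_compl.1 hw]
      simp only [← Finset.prod_mul_prod_compl C]
      rw [hf _ _ (hin z z'), hg _ _ (hout z z'),
        Finset.prod_congr rfl fun w hw => hC w hw _ _ (hin z z'),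
        Finset.prod_congr rfl fun w hw => hD w hw _ _ (hout z' z),
        Finset.prod_congr rfl fun w hw => hC w hw _ _ (hin z' z),
        Finset.prod_congr rfl fun w hw => hD w hw _ _ (hout z z')]
      ring
    all_goals
      rintro ⟨z, z'⟩ -
      ext w <;> by_cases hw : w ∈ C <;> simp [hw]
  rw [Fintype.sum_mul_sum, ← Fintype.sum_prod_type', hswap, Fintype.sum_prod_type]
  simp_rw [← Finset.mul_sum, hK.sum_prod, mul_one]

end CausalKernels

/-! ### The game given arrival times; equilibrium and symmetry constraints. -/

section Game

variable {V : Type*}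

/-- The real-valued version of `signalProb`. -/
def signalWeight (p : ℝ) (θ b : Bool) : ℝ := if b = θ then p else 1 - p

/-- The conditional probability of the signal and action of `w` given those of the earlier agents,
when the signal of `w` has the distribution `q w`. -/
noncomputable def kernel (G : SimpleGraph V) (q : V → Bool → ℝ) (σ : V → Strategy V)
    (T : V → unitInterval) (w : V) (z : V → Bool × Bool) : ℝ :=
  q w (z w).1 * (σ w (info G w T (fun u => (z u).1) (fun u => (z u).2)) (z w).2).toReal

/-- The conditional expectation of a function of signals and actions given arrival times and
state. -/
noncomputable def condMean [Fintype V] [DecidableEq V] (G : SimpleGraph V) (p : ℝ)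
    (σ : V → Strategy V) (T : V → unitInterval) (θ : Bool) (f : (V → Bool × Bool) → ℝ) : ℝ :=
  ∑ z, (∏ w, kernel G (fun _ => signalWeight p θ) σ T w z) * f z

/-- The conditional probability that `u` takes the correct action. -/
noncomputable def correct [Fintype V] [DecidableEq V] (G : SimpleGraph V) (p : ℝ)
    (σ : V → Strategy V) (u : V) (T : V → unitInterval) (θ : Bool) : ℝ :=
  condMean G p σ T θ fun z => if (z u).2 = θ then 1 else 0

open Classical in
/-- The friends of `u` who arrived before `u`. -/
noncomputable def seen [Fintype V] (G : SimpleGraph V) (u : V) (T : V → unitInterval) : Finset V :=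
  {w | G.Adj u w ∧ T w < T u}

/-- `F` only depends on the order of arrival. -/
def OrderInvariant {β : Type*} (F : (V → unitInterval) → β) : Prop :=
  ∀ T T', (∀ v u, T u < T v ↔ T' u < T' v) → F T = F T'

/-- Such an `F` factors through the finite array of comparisons `T u < T v`, so it is a simple
function; no regularity of the strategies is needed. -/
theorem OrderInvariant.measurable [Finite V] {β : Type*} [MeasurableSpace β]
    {F : (V → unitInterval) → β} (hF : OrderInvariant F) : Measurable F := by
  let e : (V → unitInterval) → V → V → Bool := fun T v u => decide (T u < T v)
  have he : Measurable e := by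
    refine measurable_pi_lambda _ fun v => measurable_pi_lambda _ fun u => ?_
    exact measurable_to_bool (by
      have : (fun T : V → unitInterval => decide (T u < T v)) ⁻¹' {true} = {T | T u < T v} := by
        ext T; simp
      rw [this]
      exact measurableSet_lt (measurable_pi_apply u) (measurable_pi_apply v))
  have : Nonempty β := ⟨F fun _ => 0⟩
  obtain ⟨g, rfl⟩ := (Function.factorsThrough_iff F (f := e)).1 fun T T' h =>
    hF T T' fun v u => by simpa [e] using congrFun (congrFun h v) u
  exact (Measurable.of_discrete (f := g)).comp he

theorem OrderInvariant.comp {β γ : Type*} {F : (V → unitInterval) → β} (hF : OrderInvariant F)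
    (g : β → γ) : OrderInvariant fun T => g (F T) := fun T T' h => congrArg g (hF T T' h)

theorem orderInvariant_info (G : SimpleGraph V) (w : V) (s a : V → Bool) :
    OrderInvariant fun T => info G w T s a := fun T T' h => by
  refine Prod.ext rfl (funext fun u => ?_)
  simp only [info]
  by_cases hu : G.Adj w u ∧ T u < T w
  · rw [if_pos hu, if_pos ⟨hu.1, (h w u).1 hu.2⟩]
  · rw [if_neg hu, if_neg fun h' => hu ⟨h'.1, (h w u).2 h'.2⟩]

theorem OrderInvariant.integrable [Fintype V] {F : (V → unitInterval) → ℝ}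
    (hF : OrderInvariant F) : Integrable F := by
  let e : (V → unitInterval) → V → V → Bool := fun T v u => decide (T u < T v)
  obtain ⟨g, hg⟩ := (Function.factorsThrough_iff F (f := e)).1 fun T T' h =>
    hF T T' fun v u => by simpa [e] using congrFun (congrFun h v) u
  obtain ⟨C, hC⟩ := (Set.finite_range g).isBounded.exists_norm_le
  refine Integrable.of_bound hF.measurable.aestronglyMeasurable C (ae_of_all _ fun T => ?_)
  rw [hg]
  exact hC _ ⟨_, rfl⟩

theorem orderInvariant_seen [Fintype V] (G : SimpleGraph V) (u : V) :
    OrderInvariant (seen G u) := fun T T' h => by ext w; simp [seen, h]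

theorem info_congr (G : SimpleGraph V) (w : V) (T : V → unitInterval) {s a s' a' : V → Bool}
    (hs : s w = s' w) (ha : ∀ u, G.Adj w u → T u < T w → a u = a' u) :
    info G w T s a = info G w T s' a' := by
  simp only [info, hs, Prod.mk.injEq, true_and]
  funext u
  split_ifs with h
  · rw [ha u h.1 h.2]
  · rfl

theorem PMF.toReal_bool_add (μ : PMF Bool) : (μ true).toReal + (μ false).toReal = 1 := by
  rw [← ENNReal.toReal_add (μ.apply_ne_top _) (μ.apply_ne_top _)]
  have h := μ.tsum_coe
  rw [tsum_fintype, Fintype.sum_bool] at h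
  rw [h, ENNReal.toReal_one]

theorem kernel_nonneg (G : SimpleGraph V) {p : ℝ} (hp : 0 ≤ p) (hp' : p ≤ 1) (σ : V → Strategy V)
    (T : V → unitInterval) (θ : Bool) (w : V) (z : V → Bool × Bool) :
    0 ≤ kernel G (fun _ => signalWeight p θ) σ T w z := by
  refine mul_nonneg ?_ ENNReal.toReal_nonneg
  simp only [signalWeight]; split_ifs <;> linarith

variable [Fintype V] [DecidableEq V]

theorem orderInvariant_condMean (G : SimpleGraph V) (p : ℝ) (σ : V → Strategy V) (θ : Bool)
    (f : (V → Bool × Bool) → ℝ) : OrderInvariant fun T => condMean G p σ T θ f := fun T T' h => by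
  simp only [condMean, kernel]
  refine Finset.sum_congr rfl fun z _ => ?_
  congr 1
  refine Finset.prod_congr rfl fun w _ => ?_
  have := orderInvariant_info G w (fun u => (z u).1) (fun u => (z u).2) T T' h
  simp only at this
  rw [this]

/-- The signal laws `q w` may differ between agents because `correct_of_follow_signal` fixes the
signal of a single agent. -/
theorem isCausal_kernel (G : SimpleGraph V) {q : V → Bool → ℝ}
    (hq : ∀ w, q w true + q w false = 1) (σ : V → Strategy V) (T : V → unitInterval) :
    IsCausal T (kernel G q σ T) where
  congr w z z' hw h := by
    simp only [kernel, hw]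
    rw [info_congr G w T (s := fun u => (z u).1) (s' := fun u => (z' u).1) (congrArg Prod.fst hw)
      fun u _ hu => congrArg Prod.snd (h u hu)]
  sum_update w z := by
    have key : ∀ x : Bool × Bool, kernel G q σ T w (Function.update z w x) =
        q w x.1 * (σ w (info G w T (fun _ => x.1) (fun u => (z u).2)) x.2).toReal := fun x => by
      simp only [kernel, Function.update_self]
      rw [info_congr G w T (s' := fun _ => x.1) (a' := fun u => (z u).2) (by simp)
        fun u _ hu => by rw [Function.update_of_ne (by rintro rfl; exact lt_irrefl _ hu)]]
    simp_rw [key, Fintype.sum_prod_type, ← Finset.mul_sum, Fintype.sum_bool,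
      PMF.toReal_bool_add, mul_one]
    exact hq w

theorem signalWeight_add (p : ℝ) (θ : Bool) :
    signalWeight p θ true + signalWeight p θ false = 1 := by
  cases θ <;> simp [signalWeight]

theorem isCausal_game (G : SimpleGraph V) (p : ℝ) (σ : V → Strategy V) (T : V → unitInterval)
    (θ : Bool) : IsCausal T (kernel G (fun _ => signalWeight p θ) σ T) :=
  isCausal_kernel G (fun _ => signalWeight_add p θ) σ T

theorem condMean_mono (G : SimpleGraph V) {p : ℝ} (hp : 0 ≤ p) (hp' : p ≤ 1) (σ : V → Strategy V)
    (T : V → unitInterval) (θ : Bool) {f g : (V → Bool × Bool) → ℝ} (h : ∀ z, f z ≤ g z) :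
    condMean G p σ T θ f ≤ condMean G p σ T θ g :=
  Finset.sum_le_sum fun z _ => mul_le_mul_of_nonneg_left (h z)
    (Finset.prod_nonneg fun w _ => kernel_nonneg G hp hp' σ T θ w z)

theorem condMean_const (G : SimpleGraph V) (p : ℝ) (σ : V → Strategy V)
    (T : V → unitInterval) (θ : Bool) (c : ℝ) : condMean G p σ T θ (fun _ => c) = c := by
  rw [condMean, ← Finset.sum_mul, (isCausal_game G p σ T θ).sum_prod, one_mul]

theorem condMean_nonneg (G : SimpleGraph V) {p : ℝ} (hp : 0 ≤ p) (hp' : p ≤ 1)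
    (σ : V → Strategy V) (T : V → unitInterval) (θ : Bool) {f : (V → Bool × Bool) → ℝ}
    (h : ∀ z, 0 ≤ f z) : 0 ≤ condMean G p σ T θ f :=
  (condMean_const G p σ T θ 0).ge.trans (condMean_mono G hp hp' σ T θ h)

theorem condMean_add (G : SimpleGraph V) (p : ℝ) (σ : V → Strategy V)
    (T : V → unitInterval) (θ : Bool) (f g : (V → Bool × Bool) → ℝ) :
    condMean G p σ T θ (fun z => f z + g z) = condMean G p σ T θ f + condMean G p σ T θ g := by
  simp [condMean, mul_add, Finset.sum_add_distrib]

theorem condMean_const_mul (G : SimpleGraph V) (p : ℝ) (σ : V → Strategy V)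
    (T : V → unitInterval) (θ : Bool) (c : ℝ) (f : (V → Bool × Bool) → ℝ) :
    condMean G p σ T θ (fun z => c * f z) = c * condMean G p σ T θ f := by
  simp only [condMean, Finset.mul_sum]
  exact Finset.sum_congr rfl fun z _ => by ring

theorem condMean_sum (G : SimpleGraph V) (p : ℝ) (σ : V → Strategy V) (T : V → unitInterval)
    (θ : Bool) {ι : Type*} (s : Finset ι) (f : ι → (V → Bool × Bool) → ℝ) :
    condMean G p σ T θ (fun z => ∑ i ∈ s, f i z) = ∑ i ∈ s, condMean G p σ T θ (f i) := by
  simp only [condMean, Finset.mul_sum]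
  exact Finset.sum_comm

theorem correct_nonneg (G : SimpleGraph V) {p : ℝ} (hp : 0 ≤ p) (hp' : p ≤ 1) (σ : V → Strategy V)
    (u : V) (T : V → unitInterval) (θ : Bool) : 0 ≤ correct G p σ u T θ := by
  exact condMean_nonneg G hp hp' σ T θ fun z => by split_ifs <;> norm_num

theorem correct_le_one (G : SimpleGraph V) {p : ℝ} (hp : 0 ≤ p) (hp' : p ≤ 1) (σ : V → Strategy V)
    (u : V) (T : V → unitInterval) (θ : Bool) : correct G p σ u T θ ≤ 1 := by
  rw [← condMean_const G p σ T θ 1]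
  exact condMean_mono G hp hp' σ T θ fun z => by split_ifs <;> norm_num

theorem orderInvariant_correct (G : SimpleGraph V) (p : ℝ) (σ : V → Strategy V) (u : V)
    (θ : Bool) : OrderInvariant fun T => correct G p σ u T θ :=
  orderInvariant_condMean G p σ θ _

theorem density_eq_ofReal (G : SimpleGraph V) {p : ℝ} (hp : 0 ≤ p) (hp' : p ≤ 1)
    (σ : V → Strategy V) (T : V → unitInterval) (θ : Bool) (z : V → Bool × Bool) :
    density G p σ (T, θ, fun u => (z u).1, fun u => (z u).2) =
      ENNReal.ofReal (2⁻¹ * ∏ w, kernel G (fun _ => signalWeight p θ) σ T w z) := by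
  rw [ENNReal.ofReal_mul (by norm_num), ENNReal.ofReal_prod_of_nonneg
    fun w _ => kernel_nonneg G hp hp' σ T θ w z]
  simp only [density, mul_assoc, ← Finset.prod_mul_distrib]
  congr 1
  · rw [ENNReal.ofReal_inv_of_pos (by norm_num)]; simp
  · refine Finset.prod_congr rfl fun w _ => ?_
    have h : 0 ≤ signalWeight p θ (z w).1 := by
      simp only [signalWeight]; split_ifs <;> linarith
    rw [kernel, ENNReal.ofReal_mul h, ENNReal.ofReal_toReal (PMF.apply_ne_top _ _)]
    congr 1
    simp only [signalProb, signalWeight]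
    split_ifs <;> rfl

theorem measurable_density (G : SimpleGraph V) (p : ℝ) (σ : V → Strategy V) :
    Measurable (density G p σ) := by
  refine measurable_from_prod_countable_left fun y => ?_
  obtain ⟨θ, s, a⟩ := y
  refine OrderInvariant.measurable fun T T' h => ?_
  simp only [density]
  congr 1
  exact Finset.prod_congr rfl fun w _ => by
    have := orderInvariant_info G w s a T T' h
    simp only at this
    rw [this]

theorem law_eq (G : SimpleGraph V) {p : ℝ} (hp : 0 ≤ p) (hp' : p ≤ 1) (σ : V → Strategy V)
    {A : Set (V → unitInterval)} (hA : MeasurableSet A) (θ b : Bool) (v : V) :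
    law G p σ {ω | ω.1 ∈ A ∧ ω.2.1 = θ ∧ ω.2.2.2 v = b} = ENNReal.ofReal
      (∫ T in A, 2⁻¹ * condMean G p σ T θ fun z => if (z v).2 = b then 1 else 0) := by
  set S : Set (Outcome V) := {ω | ω.1 ∈ A ∧ ω.2.1 = θ ∧ ω.2.2.2 v = b} with hS
  have hSm : MeasurableSet S := by
    have h1 : MeasurableSet {y : Bool × (V → Bool) × (V → Bool) | y.1 = θ ∧ y.2.2 v = b} :=
      MeasurableSet.of_discrete
    exact hA.prod h1
  have hnn : ∀ T, 0 ≤ 2⁻¹ * condMean G p σ T θ fun z => if (z v).2 = b then 1 else 0 := by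
    intro T
    exact mul_nonneg (by norm_num) (condMean_nonneg G hp hp' σ T θ fun z => by
      split_ifs <;> norm_num)
  have hoi : OrderInvariant fun T => 2⁻¹ * condMean G p σ T θ
      fun z => if (z v).2 = b then 1 else 0 :=
    (orderInvariant_condMean G p σ θ _).comp (2⁻¹ * ·)
  rw [ofReal_integral_eq_lintegral_ofReal hoi.integrable.integrableOn (ae_of_all _ hnn), law, withDensity_apply _ hSm, ← lintegral_indicator hSm,
    lintegral_prod _ ((measurable_density G p σ).indicator hSm).aemeasurable,
    ← lintegral_indicator hA]
  refine lintegral_congr fun T => ?_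
  rw [lintegral_count, tsum_fintype]
  by_cases hT : T ∈ A
  · rw [Set.indicator_of_mem hT, Fintype.sum_prod_type, Finset.sum_eq_single θ]
    · rw [← (Equiv.arrowProdEquivProdArrow V (fun _ => Bool) (fun _ => Bool)).sum_comp,
        condMean, Finset.mul_sum, ENNReal.ofReal_sum_of_nonneg]
      · refine Finset.sum_congr rfl fun z _ => ?_
        by_cases hz : (z v).2 = b
        · rw [Set.indicator_of_mem (by exact ⟨hT, rfl, hz⟩), if_pos hz, mul_one]
          exact density_eq_ofReal G hp hp' σ T θ z
        · rw [Set.indicator_of_notMem (fun h => hz h.2.2), if_neg hz]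
          simp
      · intro z _
        refine mul_nonneg (by norm_num) (mul_nonneg (Finset.prod_nonneg fun w _ =>
          kernel_nonneg G hp hp' σ T θ w z) (by split_ifs <;> norm_num))
    · intro θ' _ hθ
      exact Finset.sum_eq_zero fun y _ => Set.indicator_of_notMem (fun h => hθ h.2.1) _
    · simp
  · rw [Set.indicator_of_notMem hT]
    exact Finset.sum_eq_zero fun y _ => Set.indicator_of_notMem (fun h => hT h.1) _

theorem law_real_eq (G : SimpleGraph V) {p : ℝ} (hp : 0 ≤ p) (hp' : p ≤ 1) (σ : V → Strategy V)
    {A : Set (V → unitInterval)} (hA : MeasurableSet A) (θ : Bool) (v : V) :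
    (law G p σ).real {ω | ω.1 ∈ A ∧ ω.2.1 = θ ∧ ω.2.2.2 v = θ} =
      2⁻¹ * ∫ T in A, correct G p σ v T θ := by
  rw [Measure.real, law_eq G hp hp' σ hA, integral_const_mul, ENNReal.toReal_ofReal]
  · rfl
  · exact mul_nonneg (by norm_num) (integral_nonneg fun T => correct_nonneg G hp hp' σ v T θ)

theorem learningQuality_eq (G : SimpleGraph V) {p : ℝ} (hp : 0 ≤ p) (hp' : p ≤ 1)
    (σ : V → Strategy V) (v : V) :
    learningQuality G p σ v =
      ∫ T, 2⁻¹ * (correct G p σ v T true + correct G p σ v T false) := by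
  have hm : ∀ θ, MeasurableSet
      {ω : Outcome V | ω.1 ∈ Set.univ ∧ ω.2.1 = θ ∧ ω.2.2.2 v = θ} := fun θ => by
    have h1 : MeasurableSet {y : Bool × (V → Bool) × (V → Bool) | y.1 = θ ∧ y.2.2 v = θ} :=
      MeasurableSet.of_discrete
    exact MeasurableSet.univ.prod h1
  have h : {ω : Outcome V | ω.2.2.2 v = ω.2.1} =
      {ω : Outcome V | ω.1 ∈ Set.univ ∧ ω.2.1 = true ∧ ω.2.2.2 v = true} ∪
      {ω : Outcome V | ω.1 ∈ Set.univ ∧ ω.2.1 = false ∧ ω.2.2.2 v = false} := by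
    ext ⟨T, θ, s, a⟩
    cases θ <;> simp
  have hfin : ∀ θ, law G p σ
      {ω : Outcome V | ω.1 ∈ Set.univ ∧ ω.2.1 = θ ∧ ω.2.2.2 v = θ} ≠ ⊤ := fun θ => by
    rw [law_eq G hp hp' σ MeasurableSet.univ]
    exact ENNReal.ofReal_ne_top
  rw [learningQuality, h, measureReal_union ?_ (hm false) (hfin _) (hfin _),
    law_real_eq G hp hp' σ MeasurableSet.univ, law_real_eq G hp hp' σ MeasurableSet.univ]
  · rw [Measure.restrict_univ, integral_const_mul, integral_add, mul_add]
    · exact (orderInvariant_correct G p σ v true).integrable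
    · exact (orderInvariant_correct G p σ v false).integrable
  · rw [Set.disjoint_left]
    rintro ⟨T, θ, s, a⟩ h1 h2
    simp_all

/-- Flipping exchanges the events of being correct in the two states and fixes `T`, so both
functions have the same integral over every measurable set of arrival times. -/
theorem IsStateSymmetric.correct_ae_eq {G : SimpleGraph V} {p : ℝ} (hp : 0 ≤ p) (hp' : p ≤ 1)
    {σ : V → Strategy V} (h : IsStateSymmetric G p σ) (u : V) :
    ∀ᵐ T, correct G p σ u T true = correct G p σ u T false := by
  refine Integrable.ae_eq_of_forall_setIntegral_eq _ _
    (orderInvariant_correct G p σ u true).integrable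
    (orderInvariant_correct G p σ u false).integrable fun A hA _ => ?_
  have hm : MeasurableSet {ω : Outcome V | ω.1 ∈ A ∧ ω.2.1 = true ∧ ω.2.2.2 u = true} := by
    have h1 : MeasurableSet {y : Bool × (V → Bool) × (V → Bool) | y.1 = true ∧ y.2.2 u = true} :=
      MeasurableSet.of_discrete
    exact hA.prod h1
  have h1 := law_real_eq G hp hp' σ hA true u
  have h2 := law_real_eq G hp hp' σ hA false u
  have h3 := h.measureReal_preimage hm.nullMeasurableSet
  have h4 : flip ⁻¹' {ω : Outcome V | ω.1 ∈ A ∧ ω.2.1 = true ∧ ω.2.2.2 u = true} =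
      {ω | ω.1 ∈ A ∧ ω.2.1 = false ∧ ω.2.2.2 u = false} := by
    ext ⟨T, θ, s, a⟩
    simp [flip]
  rw [h4] at h3
  linarith

/-- Agents who follow their own signal are correct with probability `p`. -/
theorem correct_of_follow_signal (G : SimpleGraph V) (p : ℝ) (σ : V → Strategy V) (u : V)
    (T : V → unitInterval) (θ : Bool)
    (h : ∀ s a, σ u (info G u T s a) = PMF.pure (s u)) : correct G p σ u T θ = p := by
  -- Under `q` the signal of `u` is always `θ`. For an agent who copies his signal, restricting to
  -- the correct action amounts to this change of law at the price of a factor `p`.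
  let q : V → Bool → ℝ := fun w b => if w = u then (if b = θ then 1 else 0) else signalWeight p θ b
  have hq : ∀ w, q w true + q w false = 1 := fun w => by
    simp only [q]
    split_ifs <;> simp_all [signalWeight_add]
  have key : ∀ z, (∏ w, kernel G (fun _ => signalWeight p θ) σ T w z) *
      (if (z u).2 = θ then 1 else 0) = p * ∏ w, kernel G q σ T w z := fun z => by
    rw [← Finset.mul_prod_erase Finset.univ _ (Finset.mem_univ u),
      ← Finset.mul_prod_erase Finset.univ (fun w => kernel G q σ T w z) (Finset.mem_univ u)]
    have h1 : ∏ w ∈ Finset.univ.erase u, kernel G (fun _ => signalWeight p θ) σ T w z =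
        ∏ w ∈ Finset.univ.erase u, kernel G q σ T w z :=
      Finset.prod_congr rfl fun w hw => by simp [kernel, q, Finset.ne_of_mem_erase hw]
    rw [h1, mul_right_comm, ← mul_assoc]
    congr 1
    simp only [kernel, h, q, if_true, signalWeight, PMF.pure_apply]
    rcases hz : z u with ⟨s, a⟩
    cases s <;> cases a <;> cases θ <;> simp
  rw [correct, condMean, Finset.sum_congr rfl fun z _ => key z, ← Finset.mul_sum,
    (isCausal_kernel G hq σ T).sum_prod, mul_one]

theorem IsEquilibrium.update_le {G : SimpleGraph V} {p : ℝ} {σ : V → Strategy V}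
    (h : IsEquilibrium G p σ) (v : V) (τ : Strategy V) :
    learningQuality G p (Function.update σ v τ) v ≤ learningQuality G p σ v := by
  convert h v τ

/-- In an equilibrium, whatever the set of earlier friends, the action is at least as good as the
signal. -/
theorem IsEquilibrium.setIntegral_correct {G : SimpleGraph V} {p : ℝ} (hp : 0 ≤ p) (hp' : p ≤ 1)
    {σ : V → Strategy V} (h : IsEquilibrium G p σ) (u : V) (S : Finset V) :
    0 ≤ ∫ T in {T | seen G u T = S},
      (2⁻¹ * (correct G p σ u T true + correct G p σ u T false) - p) := by
  -- The deviation copies the signal exactly when the observed set is `S`; the domain of the partial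
  -- function in `I` reveals that set. Payoffs therefore change only on the event `seen G u T = S`.
  let τ : Strategy V := fun I => if ∀ w, w ∈ S ↔ (I.2 w).isSome then PMF.pure I.1 else σ u I
  have hcond : ∀ T s a, (∀ w, w ∈ S ↔ ((info G u T s a).2 w).isSome) ↔ seen G u T = S := by
    intro T s a
    rw [Finset.ext_iff]
    refine forall_congr' fun w => ?_
    simp only [info, seen, Finset.mem_filter, Finset.mem_univ, true_and]
    split_ifs with hw <;> simp [hw]
  have hm : MeasurableSet {T | seen G u T = S} := by
    have : OrderInvariant fun T => seen G u T = S := (orderInvariant_seen G u).comp (· = S)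
    exact measurableSet_setOfPred.2 this.measurable
  have h0 := h.update_le u τ
  rw [learningQuality_eq G hp hp', learningQuality_eq G hp hp', ← sub_nonneg,
    ← integral_sub] at h0
  · rw [← integral_indicator hm]
    refine h0.trans_eq (integral_congr_ae (ae_of_all _ fun T => ?_))
    by_cases hT : seen G u T = S
    · have hf : ∀ θ, correct G p (Function.update σ u τ) u T θ = p := fun θ => by
        refine correct_of_follow_signal G p _ u T θ fun s a => ?_
        rw [Function.update_self]
        simp only [τ]
        rw [if_pos ((hcond T s a).2 hT)]
        rfl
      rw [Set.indicator_of_mem (by exact hT)]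
      dsimp only
      rw [hf, hf]
      ring
    · have hf : ∀ θ, correct G p (Function.update σ u τ) u T θ = correct G p σ u T θ := fun θ => by
        refine Finset.sum_congr rfl fun z _ => ?_
        congr 1
        refine Finset.prod_congr rfl fun w _ => ?_
        by_cases hw : w = u
        · subst hw
          simp only [kernel, Function.update_self, τ]
          rw [if_neg fun h' => hT ((hcond T _ _).1 h')]
        · simp only [kernel, Function.update_of_ne hw]
      rw [Set.indicator_of_notMem (by exact hT)]
      dsimp only
      rw [hf, hf, sub_self]
  all_goals exact (((orderInvariant_correct G p _ u true).integrable).add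
    ((orderInvariant_correct G p _ u false).integrable)).const_mul _

/-- In a state-symmetric equilibrium the action of an agent is at least as good as his signal, in
each state and for every weighting of the sets of earlier friends. -/
theorem IsEquilibrium.integral_mul_correct {G : SimpleGraph V} {p : ℝ} (hp : 0 ≤ p) (hp' : p ≤ 1)
    {σ : V → Strategy V} (h : IsEquilibrium G p σ) (hs : IsStateSymmetric G p σ) (u : V)
    {c : Finset V → ℝ} (hc : ∀ S, 0 ≤ c S) (θ : Bool) :
    0 ≤ ∫ T, c (seen G u T) * (correct G p σ u T θ - p) := by
  have hm : ∀ S, MeasurableSet {T | seen G u T = S} := fun S => by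
    have : OrderInvariant fun T => seen G u T = S := (orderInvariant_seen G u).comp (· = S)
    exact measurableSet_setOfPred.2 this.measurable
  have hint : Integrable fun T => correct G p σ u T θ - p :=
    ((orderInvariant_correct G p σ u θ).comp (· - p)).integrable
  have key : ∀ T, c (seen G u T) * (correct G p σ u T θ - p) = ∑ S, c S *
      Set.indicator {T | seen G u T = S} (fun T => correct G p σ u T θ - p) T := fun T => by
    rw [Finset.sum_eq_single (seen G u T)]
    · rw [Set.indicator_of_mem (by exact rfl)]
    · intro S _ hS
      rw [Set.indicator_of_notMem (by exact hS.symm), mul_zero]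
    · simp
  simp_rw [key]
  rw [integral_finsetSum _ fun S _ => (hint.indicator (hm S)).const_mul _]
  refine Finset.sum_nonneg fun S _ => ?_
  rw [integral_const_mul, integral_indicator (hm S)]
  refine mul_nonneg (hc S) ((h.setIntegral_correct hp hp' u S).trans_eq ?_)
  refine setIntegral_congr_ae (hm S) ?_
  -- The deviation only bounds the average over the two states; symmetry turns this into a bound in
  -- each state.
  filter_upwards [hs.correct_ae_eq hp hp' u] with T hT _
  cases θ <;> rw [hT] <;> ring

end Game

/-! ### Independent uniform arrival times. -/

section ArrivalTimes

variable {V : Type*} [Fintype V] [DecidableEq V]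

theorem measurable_piecewise (C : Finset V) : Measurable
    fun q : (V → unitInterval) × (V → unitInterval) => C.piecewise q.1 q.2 := by
  refine measurable_pi_lambda _ fun w => ?_
  by_cases hw : w ∈ C
  · simpa [hw, Function.comp_def] using (measurable_pi_apply w).comp measurable_fst
  · simpa [hw, Function.comp_def] using (measurable_pi_apply w).comp measurable_snd

/-- Independent resampling of the arrival times outside a set of agents. -/
theorem measurePreserving_piecewise (C : Finset V) : MeasurePreserving
    (fun q : (V → unitInterval) × (V → unitInterval) => C.piecewise q.1 q.2)
    (volume.prod volume) volume := by
  refine ⟨measurable_piecewise C, ?_⟩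
  rw [volume_pi]
  refine (Measure.pi_eq fun s hs => ?_).symm
  rw [Measure.map_apply (measurable_piecewise C) (MeasurableSet.univ_pi hs)]
  have : (fun q : (V → unitInterval) × (V → unitInterval) => C.piecewise q.1 q.2) ⁻¹'
      Set.univ.pi s = (Set.univ.pi fun w => if w ∈ C then s w else Set.univ) ×ˢ
        (Set.univ.pi fun w => if w ∈ C then Set.univ else s w) := by
    ext ⟨T, T'⟩
    simp only [Set.mem_preimage, Set.mem_univ_pi, Set.mem_prod, ← forall_and]
    refine forall_congr' fun w => ?_
    by_cases hw : w ∈ C <;> simp [hw]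
  rw [this, Measure.prod_prod, Measure.pi_pi, Measure.pi_pi, ← Finset.prod_mul_distrib]
  refine Finset.prod_congr rfl fun w _ => ?_
  by_cases hw : w ∈ C <;> simp [hw]

/-- Functions of the arrival times of disjoint sets of agents are independent. -/
theorem integral_mul_of_dependsOnlyOn {C D : Finset V} (hCD : Disjoint C D)
    {f g : (V → unitInterval) → ℝ} (hf : DependsOnlyOn C f) (hg : DependsOnlyOn D g)
    (hfm : Measurable f) (hgm : Measurable g) :
    ∫ T, f T * g T = (∫ T, f T) * ∫ T, g T := by
  have h := measurePreserving_piecewise (V := V) C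
  have h0 := integral_map (μ := (volume : Measure ((V → unitInterval) × (V → unitInterval))))
    h.measurable.aemeasurable (f := fun T => f T * g T)
    (hfm.mul hgm).aestronglyMeasurable
  rw [← Measure.volume_eq_prod] at h
  rw [h.map_eq] at h0
  rw [← integral_prod_mul, h0, Measure.volume_eq_prod]
  refine integral_congr_ae (ae_of_all _ fun q => ?_)
  dsimp only
  rw [hf q.1 _ fun w hw => (C.piecewise_eq_of_mem _ _ hw).symm,
    hg q.2 _ fun w hw => (C.piecewise_eq_of_notMem _ _ (Finset.disjoint_right.1 hCD hw)).symm]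

theorem measurable_update_prod (v : V) : Measurable
    fun q : (V → unitInterval) × unitInterval => Function.update q.1 v q.2 := by
  refine measurable_pi_lambda _ fun w => ?_
  by_cases hw : w = v
  · subst hw; simpa using measurable_snd
  · simpa [hw, Function.comp_def] using (measurable_pi_apply w).comp measurable_fst

/-- Independent resampling of the arrival time of one agent. -/
theorem measurePreserving_update (v : V) : MeasurePreserving
    (fun q : (V → unitInterval) × unitInterval => Function.update q.1 v q.2)
    (volume.prod volume) volume := by
  refine ⟨measurable_update_prod v, ?_⟩
  rw [volume_pi]
  refine (Measure.pi_eq fun s hs => ?_).symm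
  rw [Measure.map_apply (measurable_update_prod v) (MeasurableSet.univ_pi hs)]
  have : (fun q : (V → unitInterval) × unitInterval => Function.update q.1 v q.2) ⁻¹'
      Set.univ.pi s = (Set.univ.pi (Function.update s v Set.univ)) ×ˢ s v := by
    ext ⟨T, t⟩
    simp only [Set.mem_preimage, Set.mem_univ_pi, Set.mem_prod]
    constructor
    · refine fun h => ⟨fun w => ?_, by simpa using h v⟩
      by_cases hw : w = v
      · subst hw; simp
      · simpa [hw] using h w
    · rintro ⟨h, ht⟩ w
      by_cases hw : w = v
      · subst hw; simpa using ht
      · simpa [hw] using h w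
  rw [this, Measure.prod_prod, Measure.pi_pi,
    ← Finset.prod_erase_mul _ _ (Finset.mem_univ v),
    ← Finset.prod_erase_mul _ (fun i => volume (s i)) (Finset.mem_univ v)]
  simp only [Function.update_self, measure_univ, mul_one]
  congr 1
  exact Finset.prod_congr rfl fun w hw => by
    rw [Function.update_of_ne (Finset.ne_of_mem_erase hw)]

theorem integral_eq_integral_update (v : V) {F : (V → unitInterval) → ℝ} (hF : Measurable F)
    {c : ℝ} (hc : ∀ T, |F T| ≤ c) :
    ∫ T, F T = ∫ T, ∫ t, F (Function.update T v t) := by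
  have h := measurePreserving_update (V := V) v
  have h0 := integral_map (μ := (volume : Measure ((V → unitInterval) × unitInterval)))
    h.measurable.aemeasurable hF.aestronglyMeasurable
  rw [← Measure.volume_eq_prod] at h
  rw [h.map_eq] at h0
  rw [h0, Measure.volume_eq_prod, integral_prod]
  exact Integrable.of_bound (hF.comp h.measurable).aestronglyMeasurable c
    (ae_of_all _ fun q => hc _)

theorem integral_eq_integral_update' (v : V) {F : (V → unitInterval) → ℝ} (hF : Measurable F)
    {c : ℝ} (hc : ∀ T, |F T| ≤ c) :
    ∫ T, F T = ∫ t, ∫ T, F (Function.update T v t) := by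
  rw [integral_eq_integral_update v hF hc]
  refine integral_integral_swap ?_
  exact Integrable.of_bound (hF.comp (measurable_update_prod v)).aestronglyMeasurable c
    (ae_of_all _ fun q => hc _)

theorem integral_ite_lt (x : unitInterval) :
    ∫ t : unitInterval, (if t < x then (1 : ℝ) else 0) = x := by
  have : (fun t : unitInterval => if t < x then (1 : ℝ) else 0) =
      Set.indicator (Set.Iio x) fun _ => 1 := by
    ext t; simp [Set.indicator_apply]
  rw [this, integral_indicator measurableSet_Iio, setIntegral_const, Measure.real,
    unitInterval.volume_Iio, ENNReal.toReal_ofReal x.2.1]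
  simp

theorem integral_ite_gt (x : unitInterval) :
    ∫ t : unitInterval, (if x < t then (1 : ℝ) else 0) = 1 - x := by
  have : (fun t : unitInterval => if x < t then (1 : ℝ) else 0) =
      Set.indicator (Set.Ioi x) fun _ => 1 := by
    ext t; simp [Set.indicator_apply]
  rw [this, integral_indicator measurableSet_Ioi, setIntegral_const, Measure.real,
    unitInterval.volume_Ioi, ENNReal.toReal_ofReal (sub_nonneg.2 x.2.2)]
  simp

theorem measurable_ite_lt {f g : (V → unitInterval) → unitInterval} (hf : Measurable f)
    (hg : Measurable g) : Measurable fun T => if f T < g T then (1 : ℝ) else 0 :=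
  Measurable.ite (measurableSet_lt hf hg) measurable_const measurable_const

theorem ae_ne_of_ne {u v : V} (h : u ≠ v) :
    ∀ᵐ T : V → unitInterval, T u ≠ T v := by
  have hm : MeasurableSet {T : V → unitInterval | T u = T v} :=
    measurableSet_eq_fun (measurable_pi_apply u) (measurable_pi_apply v)
  rw [ae_iff]
  simp only [ne_eq, not_not]
  have hp := measurePreserving_update (V := V) u
  rw [← hp.measure_preimage hm.nullMeasurableSet, Measure.prod_apply (hp.measurable hm)]
  refine lintegral_eq_zero_of_ae_eq_zero (ae_of_all _ fun T => ?_)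
  have : Prod.mk T ⁻¹' ((fun q : (V → unitInterval) × unitInterval =>
      Function.update q.1 u q.2) ⁻¹' {T | T u = T v}) = {T v} := by
    ext t; simp [h.symm]
  simp only [this, Pi.zero_apply, measure_singleton]

/-- The fraction of early arrivals among the agents in `N` estimates the arrival time of `u`. -/
theorem integral_sq_sum_le {u : V} {N : Finset V} (hu : u ∉ N) :
    ∫ T : V → unitInterval, (∑ w ∈ N, ((if T w < T u then (1 : ℝ) else 0) - T u)) ^ 2 ≤
      N.card := by
  set X : V → (V → unitInterval) → ℝ := fun w T => (if T w < T u then (1 : ℝ) else 0) - T u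
    with hX
  have hXm : ∀ w, Measurable (X w) := fun w =>
    (measurable_ite_lt (measurable_pi_apply w) (measurable_pi_apply u)).sub
      (measurable_subtype_coe.comp (measurable_pi_apply u))
  have hXb : ∀ w T, |X w T| ≤ 1 := fun w T => by
    have h0 := (T u).2.1
    have h1 := (T u).2.2
    simp only [hX]
    rw [abs_le]; split_ifs <;> constructor <;> linarith
  have hXXb : ∀ w w' T, |X w T * X w' T| ≤ 1 := fun w w' T => by
    rw [abs_mul]; exact mul_le_one₀ (hXb w T) (abs_nonneg _) (hXb w' T)
  have hint : ∀ w w', Integrable fun T => X w T * X w' T := fun w w' =>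
    Integrable.of_bound ((hXm w).mul (hXm w')).aestronglyMeasurable 1
      (ae_of_all _ fun T => hXXb w w' T)
  -- Given `T u`, the variable `X w` has mean zero over `T w`, and `X w'` does not involve `T w`.
  have hcross : ∀ w ∈ N, ∀ w' ∈ N, w ≠ w' → ∫ T, X w T * X w' T = 0 := by
    intro w hw w' hw' hne
    rw [integral_eq_integral_update w (F := fun T => X w T * X w' T) ((hXm w).mul (hXm w'))
      (hXXb w w')]
    refine integral_eq_zero_of_ae (ae_of_all _ fun T => ?_)
    have huw : u ≠ w := fun h => hu (h ▸ hw)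
    simp only [hX, Function.update_self, Function.update_of_ne huw,
      Function.update_of_ne hne.symm, Pi.zero_apply]
    rw [integral_mul_const, integral_sub, integral_ite_lt]
    · simp
    · exact Integrable.of_bound (Measurable.ite measurableSet_Iio measurable_const
        measurable_const).aestronglyMeasurable 1 (ae_of_all _ fun t => by split_ifs <;> simp)
    · exact integrable_const _
  calc ∫ T : V → unitInterval, (∑ w ∈ N, X w T) ^ 2
      = ∫ T : V → unitInterval, ∑ w ∈ N, ∑ w' ∈ N, X w T * X w' T := by
        simp_rw [sq, Finset.sum_mul_sum]
    _ = ∑ w ∈ N, ∑ w' ∈ N, ∫ T, X w T * X w' T := by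
        rw [integral_finsetSum _ fun w _ => integrable_finsetSum _ fun w' _ => hint w w']
        exact Finset.sum_congr rfl fun w _ => integral_finsetSum _ fun w' _ => hint w w'
    _ = ∑ w ∈ N, ∫ T, X w T * X w T := Finset.sum_congr rfl fun w hw =>
        Finset.sum_eq_single w (fun w' hw' h => hcross w hw w' hw' h.symm) (fun h => (h hw).elim)
    _ ≤ ∑ w ∈ N, (1 : ℝ) := Finset.sum_le_sum fun w _ => by
        have := integral_mono (hint w w) (integrable_const 1)
          fun T => (le_abs_self _).trans (hXXb w w T)
        simpa using this
    _ = N.card := by simp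

theorem integral_abs_card_div_sub_le {u : V} {N : Finset V} (hu : u ∉ N) (hN : 0 < N.card) :
    ∫ T : V → unitInterval, |((N.filter fun w => T w < T u).card : ℝ) / N.card - T u| ≤
      1 / √N.card := by
  set n : ℝ := (N.card : ℝ) with hn
  have hn0 : 0 < n := by simpa [hn] using hN
  set Y : (V → unitInterval) → ℝ := fun T =>
    ∑ w ∈ N, ((if T w < T u then (1 : ℝ) else 0) - T u) with hY
  have hYeq : ∀ T : V → unitInterval,
      ((N.filter fun w => T w < T u).card : ℝ) / n - T u = Y T / n := fun T => by
    simp only [hY, Finset.sum_sub_distrib, Finset.sum_boole, Finset.sum_const, nsmul_eq_mul]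
    field_simp
    simp [hn, mul_comm]
  have hYm : Measurable Y := Finset.measurable_sum _ fun w _ =>
    (measurable_ite_lt (measurable_pi_apply w) (measurable_pi_apply u)).sub
      (measurable_subtype_coe.comp (measurable_pi_apply u))
  have hYb : ∀ T, |Y T| ≤ n := fun T => by
    refine (Finset.abs_sum_le_sum_abs _ _).trans ?_
    have : ∀ w ∈ N, |(if T w < T u then (1 : ℝ) else 0) - T u| ≤ 1 := fun w _ => by
      have h0 := (T u).2.1
      have h1 := (T u).2.2
      rw [abs_le]; split_ifs <;> constructor <;> linarith
    simpa [hn] using Finset.sum_le_sum this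
  have hs : 0 < √n := Real.sqrt_pos.2 hn0
  have hY2 : Integrable fun T => (Y T) ^ 2 :=
    Integrable.of_bound (hYm.pow_const 2).aestronglyMeasurable (n ^ 2) (ae_of_all _ fun T => by
      rw [Real.norm_eq_abs, abs_pow]; exact pow_le_pow_left₀ (abs_nonneg _) (hYb T) 2)
  -- This is `(|Y| - √n) ^ 2 ≥ 0` rescaled, with `√n` chosen to match the second moment bound `n`.
  have hpt : ∀ T, |Y T / n| ≤ (Y T) ^ 2 * (1 / (2 * n * √n)) + 1 / (2 * √n) := fun T => by
    rw [abs_div, abs_of_pos hn0, ← sq_abs (Y T)]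
    have h1 : 0 ≤ (|Y T| - √n) ^ 2 / (2 * n * √n) := by positivity
    have h2 : (|Y T| - √n) ^ 2 / (2 * n * √n) =
        |Y T| ^ 2 * (1 / (2 * n * √n)) + 1 / (2 * √n) - |Y T| / n := by
      field_simp
      rw [sub_sq, Real.sq_sqrt hn0.le]
      ring
    linarith
  simp_rw [hYeq]
  have hintR : Integrable fun T => (Y T) ^ 2 * (1 / (2 * n * √n)) + 1 / (2 * √n) :=
    (hY2.mul_const _).add (integrable_const _)
  refine (integral_mono_of_nonneg (ae_of_all _ fun T => abs_nonneg _) hintR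
    (ae_of_all _ hpt)).trans ?_
  rw [integral_add (hY2.mul_const _) (integrable_const _), integral_mul_const]
  have h3 : (∫ T, (Y T) ^ 2) * (1 / (2 * n * √n)) ≤ n * (1 / (2 * n * √n)) :=
    mul_le_mul_of_nonneg_right (integral_sq_sum_le hu) (by positivity)
  have h4 : n * (1 / (2 * n * √n)) + 1 / (2 * √n) = 1 / √n := by field_simp; norm_num
  simp only [integral_const, probReal_univ, smul_eq_mul, one_mul]
  linarith

theorem measurePreserving_comp_perm (e : Equiv.Perm V) :
    MeasurePreserving (fun T : V → unitInterval => T ∘ e) volume volume := by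
  convert volume_measurePreserving_piCongrLeft (fun _ : V => unitInterval) e.symm using 1
  ext T w
  have := (MeasurableEquiv.piCongrLeft_apply_apply (β := fun _ : V => unitInterval) e.symm T (e w))
  simp_all

/-- `n` agents arrive in a given order with probability at most `1 / n!`. -/
theorem measureReal_strictAnti_le {n : ℕ} (w : Fin n ↪ V) :
    (volume : Measure (V → unitInterval)).real {T | StrictAnti (T ∘ w)} ≤ 1 / (n.factorial : ℝ) := by
  have hm : MeasurableSet {T : V → unitInterval | StrictAnti (T ∘ w)} := by
    have : {T : V → unitInterval | StrictAnti (T ∘ w)} =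
        ⋂ (i : Fin n) (j : Fin n) (_ : i < j), {T | T (w j) < T (w i)} := by
      ext T; simp [StrictAnti]
    rw [this]
    exact MeasurableSet.iInter fun i => MeasurableSet.iInter fun j => MeasurableSet.iInter fun _ =>
      measurableSet_lt (measurable_pi_apply _) (measurable_pi_apply _)
  -- The `n!` orderings of the chosen agents are equiprobable by exchangeability and mutually
  -- exclusive, because the only increasing permutation of `Fin n` is the identity.
  let A : Equiv.Perm (Fin n) → Set (V → unitInterval) := fun π =>
    (fun T : V → unitInterval => T ∘ (π.viaFintypeEmbedding w)) ⁻¹' {T | StrictAnti (T ∘ w)}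
  have hA : ∀ π, A π = {T | StrictAnti (T ∘ w ∘ π)} := fun π => by
    ext T
    have : (T ∘ (π.viaFintypeEmbedding w)) ∘ w = T ∘ w ∘ π := by
      ext i; simp
    simp only [A, Set.mem_preimage, Set.mem_ofPred_eq, this]
  have hAm : ∀ π, MeasurableSet (A π) := fun π =>
    (measurePreserving_comp_perm _).measurable hm
  have hvol : ∀ π, volume.real (A π) = volume.real {T : V → unitInterval | StrictAnti (T ∘ w)} :=
    fun π => (measurePreserving_comp_perm _).measureReal_preimage hm.nullMeasurableSet
  have hdisj : Pairwise (Function.onFun Disjoint A) := by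
    intro π π' hne
    rw [Function.onFun, Set.disjoint_left, hA, hA]
    intro T (h : StrictAnti (T ∘ w ∘ π)) (h' : StrictAnti (T ∘ w ∘ π'))
    apply hne
    have hmono : StrictMono (π'⁻¹ * π) := by
      intro i j hij
      have h1 := h hij
      rw [← h'.lt_iff_gt]
      simpa using h1
    have h2 : hmono.orderIsoOfSurjective _ (π'⁻¹ * π).surjective = OrderIso.refl _ :=
      Subsingleton.elim _ _
    have h3 : π'⁻¹ * π = 1 := Equiv.ext fun i => DFunLike.congr_fun h2 i
    exact (inv_mul_eq_one.1 h3).symm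
  have hsum : ∑ π : Equiv.Perm (Fin n), volume.real (A π) ≤ 1 := by
    rw [← measureReal_biUnion_finset (fun π _ π' _ h => hdisj h) fun π _ => hAm π]
    exact measureReal_le_one
  simp only [hvol, Finset.sum_const, Finset.card_univ, Fintype.card_perm, Fintype.card_fin,
    nsmul_eq_mul] at hsum
  rw [le_div_iff₀ (by positivity), mul_comm]
  exact hsum

end ArrivalTimes

/-! ### Lipschitz weights replacing the indicator of early arrival. -/

section Cutoff

/-- A Lipschitz approximation of the indicator function of `x < t`. -/
noncomputable def softCutoff (κ t x : ℝ) : ℝ := max 0 (min 1 ((t - x) / κ))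

/-- The soft cutoff, divided by the probability `1 - x` of arriving after time `x`. -/
noncomputable def weightedCutoff (η κ t x : ℝ) : ℝ := softCutoff κ t x / max (1 - x) η

variable {η κ t x y : ℝ}

theorem softCutoff_nonneg : 0 ≤ softCutoff κ t x := le_max_left _ _

theorem softCutoff_le_one : softCutoff κ t x ≤ 1 := max_le zero_le_one (min_le_left _ _)

theorem softCutoff_eq_zero (hκ : 0 < κ) (h : t ≤ x) : softCutoff κ t x = 0 :=
  max_eq_left ((min_le_right _ _).trans (div_nonpos_of_nonpos_of_nonneg (by linarith) hκ.le))

theorem softCutoff_eq_one (hκ : 0 < κ) (h : x ≤ t - κ) : softCutoff κ t x = 1 := by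
  have : 1 ≤ (t - x) / κ := (le_div_iff₀ hκ).2 (by linarith)
  rw [softCutoff, min_eq_left this, max_eq_right zero_le_one]

theorem abs_softCutoff_sub_le (hκ : 0 < κ) :
    |softCutoff κ t x - softCutoff κ t y| ≤ |x - y| / κ := by
  have h : |(t - x) / κ - (t - y) / κ| = |x - y| / κ := by
    rw [← sub_div, abs_div, abs_of_pos hκ, ← abs_neg]; ring_nf
  rw [← h]
  simp only [softCutoff]
  generalize (t - x) / κ = a
  generalize (t - y) / κ = b
  rcases abs_cases (a - b) with h | h <;> rw [abs_le] <;> grind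

theorem weightedCutoff_nonneg (hη : 0 < η) : 0 ≤ weightedCutoff η κ t x :=
  div_nonneg softCutoff_nonneg (hη.le.trans (le_max_right _ _))

theorem weightedCutoff_le (hη : 0 < η) : weightedCutoff η κ t x ≤ 1 / η :=
  div_le_div₀ zero_le_one softCutoff_le_one hη (le_max_right _ _)

/-- The floor `η` in the denominator is active only for `x > 1 - η ≥ t`, where the cutoff already
vanishes. -/
theorem one_sub_mul_weightedCutoff (hη : 0 < η) (hκ : 0 < κ) (ht : t ≤ 1 - η) :
    (1 - x) * weightedCutoff η κ t x = softCutoff κ t x := by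
  rcases le_or_gt t x with h | h
  · rw [weightedCutoff, softCutoff_eq_zero hκ h]; simp
  · rw [weightedCutoff, max_eq_left (by linarith), mul_div_cancel₀]
    linarith

/-- The numerator has Lipschitz constant `1 / κ` and the reciprocal of the floored denominator `1 /
η ^ 2`. This is what allows the weight to be evaluated at an estimate of the arrival time. -/
theorem abs_weightedCutoff_sub_le (hη : 0 < η) (hκ : 0 < κ) :
    |weightedCutoff η κ t x - weightedCutoff η κ t y| ≤
      (1 / (κ * η) + 1 / η ^ 2) * |x - y| := by
  set m := max (1 - x) η with hm
  set n := max (1 - y) η with hn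
  have hm1 : η ≤ m := le_max_right _ _
  have hn1 : η ≤ n := le_max_right _ _
  have hm0 : 0 < m := hη.trans_le hm1
  have hn0 : 0 < n := hη.trans_le hn1
  have hmn : |n - m| ≤ |x - y| := by
    rw [hm, hn]
    refine (abs_max_sub_max_le_abs _ _ _).trans_eq ?_
    ring_nf
  have h1 : weightedCutoff η κ t x - weightedCutoff η κ t y =
      (softCutoff κ t x - softCutoff κ t y) / m + softCutoff κ t y * ((n - m) / (m * n)) := by
    simp only [weightedCutoff, ← hm, ← hn]
    field_simp
    ring
  rw [h1, add_mul]
  refine (abs_add_le _ _).trans (add_le_add ?_ ?_)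
  · rw [abs_div, abs_of_pos hm0]
    calc |softCutoff κ t x - softCutoff κ t y| / m ≤ (|x - y| / κ) / η :=
          div_le_div₀ (by positivity) (abs_softCutoff_sub_le hκ) hη hm1
      _ = 1 / (κ * η) * |x - y| := by field_simp
  · rw [abs_mul, abs_of_nonneg softCutoff_nonneg, abs_div, abs_of_pos (mul_pos hm0 hn0)]
    calc softCutoff κ t y * (|n - m| / (m * n)) ≤ 1 * (|x - y| / (η * η)) :=
          mul_le_mul softCutoff_le_one (div_le_div₀ (abs_nonneg _) hmn (by positivity)
            (mul_le_mul hm1 hn1 hη.le hm0.le)) (by positivity) zero_le_one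
      _ = 1 / η ^ 2 * |x - y| := by field_simp

theorem measurable_softCutoff : Measurable (softCutoff κ t) := by
  unfold softCutoff; fun_prop

theorem measurable_weightedCutoff : Measurable (weightedCutoff η κ t) := by
  unfold weightedCutoff softCutoff; fun_prop

end Cutoff

/-! ### From conditioning on the number of friends seen to conditioning on arrival time. -/

section SignalBound

variable {V : Type*} [Fintype V] [DecidableEq V]

theorem integrable_of_abs_le {α : Type*} [MeasurableSpace α] {μ : Measure α} [IsFiniteMeasure μ]
    {f : α → ℝ} (hf : Measurable f) {c : ℝ} (hc : ∀ x, |f x| ≤ c) : Integrable f μ :=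
  Integrable.of_bound hf.aestronglyMeasurable c (ae_of_all _ hc)

theorem integral_coord (u : V) {g : unitInterval → ℝ} (hg : Measurable g) :
    ∫ T : V → unitInterval, g (T u) = ∫ t, g t := by
  have h := measurePreserving_eval (fun _ : V => (volume : Measure unitInterval)) u
  have h0 := integral_map (μ := (volume : Measure (V → unitInterval)))
    h.measurable.aemeasurable (f := g) hg.aestronglyMeasurable
  rw [volume_pi, h.map_eq] at h0
  rw [h0, volume_pi]

/-- Let `Γ T` be the expected signed correctness of `u`, which agrees outside the event `B` with a
quantity `γ T` not depending on the arrival of `v`. If `Γ` averages to at least `ε` for each number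
of friends who are seen, then `γ` averages to about `ε` on the event that `u` arrives before
time `t`. -/
theorem integral_before_ge {u v : V} (huv : u ≠ v) {N : Finset V} (huN : u ∉ N)
    (hN : 0 < N.card) {Γ γ : (V → unitInterval) → ℝ} (hΓm : Measurable Γ) (hγm : Measurable γ)
    (hΓ : ∀ T, |Γ T| ≤ 1) (hγ : ∀ T, |γ T| ≤ 1) {ε β : ℝ} (hε : 0 ≤ ε) (hε' : ε ≤ 1)
    {B : Set (V → unitInterval)} (hBm : MeasurableSet B) (hB : volume.real B ≤ β)
    (hdev : ∀ c : ℕ → ℝ, (∀ k, 0 ≤ c k) → 0 ≤ ∫ T : V → unitInterval,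
      (if T u < T v then (1 : ℝ) else 0) * c (N.filter fun w => T w < T u).card * (Γ T - ε))
    (hΓγ : ∀ T, T u < T v → T ∉ B → Γ T = γ T) (hγv : ∀ T t, γ (Function.update T v t) = γ T)
    {η κ : ℝ} (hη : 0 < η) (hκ : 0 < κ) {t : unitInterval} (ht : (t : ℝ) ≤ 1 - η) :
    ε * t - 2 * κ - 2 * β / η - 2 * (1 / (κ * η) + 1 / η ^ 2) / √N.card ≤
      ∫ T : V → unitInterval, (if T u < t then (1 : ℝ) else 0) * γ T := by
  set L : ℝ := 1 / (κ * η) + 1 / η ^ 2 with hL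
  have hL0 : 0 ≤ L := by positivity
  set n : ℝ := (N.card : ℝ) with hn
  set A : (V → unitInterval) → ℝ := fun T => if T u < T v then (1 : ℝ) else 0 with hA
  set F : (V → unitInterval) → ℕ := fun T => (N.filter fun w => T w < T u).card with hF
  set φ : ℝ → ℝ := weightedCutoff η κ t with hφ
  have hφm : Measurable φ := measurable_weightedCutoff
  have hum : Measurable fun T : V → unitInterval => (T u : ℝ) :=
    measurable_subtype_coe.comp (measurable_pi_apply u)
  have hAm : Measurable A := measurable_ite_lt (measurable_pi_apply u) (measurable_pi_apply v)
  have hA0 : ∀ T, 0 ≤ A T := fun T => by simp only [hA]; split_ifs <;> norm_num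
  have hA1 : ∀ T, A T ≤ 1 := fun T => by simp only [hA]; split_ifs <;> norm_num
  have hFm : Measurable F := OrderInvariant.measurable fun T T' h => by simp only [hF, h]
  have hFRm : Measurable fun T => (F T : ℝ) / n :=
    (Measurable.of_discrete (f := fun k : ℕ => (k : ℝ) / n)).comp hFm
  have hφ0 : ∀ x, 0 ≤ φ x := fun x => weightedCutoff_nonneg hη
  have hφ1 : ∀ x, φ x ≤ 1 / η := fun x => weightedCutoff_le hη
  have hγε : ∀ T, |γ T - ε| ≤ 2 := fun T => by
    have := abs_le.1 (hγ T); rw [abs_le]; constructor <;> linarith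
  have hΓε : ∀ T, |Γ T - ε| ≤ 2 := fun T => by
    have := abs_le.1 (hΓ T); rw [abs_le]; constructor <;> linarith
  have hprod : ∀ {g : (V → unitInterval) → ℝ} {x : ℝ} {T}, |g T| ≤ 2 →
      |A T * φ x * g T| ≤ 1 / η * 2 := fun {g x T} hg => by
    rw [abs_mul, abs_of_nonneg (mul_nonneg (hA0 T) (hφ0 x))]
    refine mul_le_mul ?_ hg (abs_nonneg _) (by positivity)
    calc A T * φ x ≤ 1 * (1 / η) := mul_le_mul (hA1 T) (hφ1 x) (hφ0 x) zero_le_one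
      _ = 1 / η := one_mul _
  have hP1m : Measurable fun T => A T * φ (F T / n) * (Γ T - ε) :=
    (hAm.mul (hφm.comp hFRm)).mul (hΓm.sub_const ε)
  have hP2m : Measurable fun T => A T * φ (T u) * (γ T - ε) :=
    (hAm.mul (hφm.comp hum)).mul (hγm.sub_const ε)
  have hI1 : Integrable fun T => A T * φ (F T / n) * (Γ T - ε) :=
    integrable_of_abs_le hP1m fun T => hprod (g := fun T => Γ T - ε) (hΓε T)
  have hI2 : Integrable fun T => A T * φ (T u) * (γ T - ε) :=
    integrable_of_abs_le hP2m fun T => hprod (g := fun T => γ T - ε) (hγε T)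
  have hYi : Integrable fun T : V → unitInterval => |(F T : ℝ) / n - T u| := by
    refine integrable_of_abs_le (c := 1) (hFRm.sub hum).abs fun T => ?_
    have h0 := (T u).2.1
    have h1 := (T u).2.2
    have hn0 : 0 < n := by simpa [hn] using hN
    have h2 : (F T : ℝ) / n ≤ 1 := by
      rw [div_le_one hn0]
      exact Nat.cast_le.2 (Finset.card_filter_le _ _)
    have h3 : 0 ≤ (F T : ℝ) / n := by positivity
    rw [abs_abs, abs_le]; constructor <;> linarith
  have hBi : Integrable (B.indicator fun _ => (1 : ℝ)) := (integrable_const _).indicator hBm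
  have hI3 : Integrable fun T => A T * φ (T u) * (γ T - ε) +
      2 / η * B.indicator (fun _ => (1 : ℝ)) T := hI2.add (hBi.const_mul _)
  have step1 : ∫ T, A T * φ (F T / n) * (Γ T - ε) ≤
      ∫ T, (A T * φ (T u) * (γ T - ε) + 2 / η * B.indicator (fun _ => (1 : ℝ)) T +
        2 * L * |(F T : ℝ) / n - T u|) := by
    refine integral_mono hI1 (hI3.add (hYi.const_mul _)) fun T => ?_
    -- Replacing `Γ` by `γ` costs something only on `B`, where the weight is at most `1 / η` and the
    -- difference at most 2.
    have e1 : A T * φ (F T / n) * (Γ T - ε) ≤ A T * φ (F T / n) * (γ T - ε) +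
        2 / η * B.indicator (fun _ => (1 : ℝ)) T := by
      by_cases hT : T u < T v
      · by_cases hTB : T ∈ B
        · rw [Set.indicator_of_mem hTB]
          have : A T * φ (F T / n) * (Γ T - γ T) ≤ 1 / η * 2 :=
            (le_abs_self _).trans (hprod (g := fun T => Γ T - γ T) (by
              have h1 := abs_le.1 (hΓ T)
              have h2 := abs_le.1 (hγ T)
              rw [abs_le]; constructor <;> linarith))
          have e : 2 / η = 1 / η * 2 := by ring
          rw [e]
          linarith
        · rw [Set.indicator_of_notMem hTB, hΓγ T hT hTB]; simp
      · have hAT : A T = 0 := if_neg hT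
        rw [hAT]
        have : 0 ≤ 2 / η * B.indicator (fun _ => (1 : ℝ)) T :=
          mul_nonneg (by positivity) (Set.indicator_nonneg (fun _ _ => zero_le_one) _)
        simpa using this
    -- The observed fraction is replaced by the true arrival time through the Lipschitz bound.
    have e2 : A T * φ (F T / n) * (γ T - ε) ≤ A T * φ (T u) * (γ T - ε) +
        2 * L * |(F T : ℝ) / n - T u| := by
      have h1 : |φ (F T / n) - φ (T u)| ≤ L * |(F T : ℝ) / n - T u| :=
        abs_weightedCutoff_sub_le hη hκ
      have h2 : A T * ((φ (F T / n) - φ (T u)) * (γ T - ε)) ≤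
          1 * (L * |(F T : ℝ) / n - T u| * 2) := by
        refine (le_abs_self _).trans ?_
        rw [abs_mul, abs_mul, abs_of_nonneg (hA0 T)]
        exact mul_le_mul (hA1 T) (mul_le_mul h1 (hγε T) (abs_nonneg _) (by positivity))
          (by positivity) zero_le_one
      linarith
    dsimp only
    linarith
  rw [integral_add hI3 (hYi.const_mul _),
    integral_add hI2 (hBi.const_mul _), integral_const_mul, integral_const_mul,
    integral_indicator_const _ hBm, smul_eq_mul, mul_one] at step1
  -- Integrating over the arrival time of `v`, on which `γ` does not depend, produces the factor `1
  -- - T u` that cancels the denominator of the weight.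
  have step2 : ∫ T, A T * φ (T u) * (γ T - ε) =
      ∫ T : V → unitInterval, softCutoff κ t (T u) * (γ T - ε) := by
    rw [integral_eq_integral_update v hP2m fun T => hprod (g := fun T => γ T - ε) (hγε T)]
    refine integral_congr_ae (ae_of_all _ fun T => ?_)
    simp only [hA, Function.update_self, Function.update_of_ne huv, hγv]
    simp_rw [mul_assoc]
    rw [integral_mul_const, integral_ite_gt, ← mul_assoc, one_sub_mul_weightedCutoff hη hκ ht]
  -- The window where the soft and the sharp cutoff can differ; its mass is at most `κ`.
  set K : unitInterval → ℝ := fun x => if (t : ℝ) - κ ≤ x ∧ x < t then (1 : ℝ) else 0 with hK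
  have hKs : MeasurableSet {x : unitInterval | (t : ℝ) - κ ≤ x ∧ x < t} :=
    (measurableSet_le measurable_const measurable_subtype_coe).inter measurableSet_Iio
  have hKm : Measurable K := Measurable.ite hKs measurable_const measurable_const
  have hKi : Integrable fun T : V → unitInterval => K (T u) :=
    integrable_of_abs_le (c := 1) (hKm.comp (measurable_pi_apply u)) fun T => by
      simp only [hK]; split_ifs <;> simp
  have hKint : ∫ T : V → unitInterval, K (T u) ≤ κ := by
    rw [integral_coord u hKm]
    have : K = Set.indicator {x : unitInterval | (t : ℝ) - κ ≤ x ∧ x < t} fun _ => 1 := by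
      ext x; simp [hK, Set.indicator_apply]
    rw [this, integral_indicator_const _ hKs, smul_eq_mul, mul_one, Measure.real,
      unitInterval.volume_apply]
    refine ENNReal.toReal_le_of_le_ofReal hκ.le ?_
    have hsub : Subtype.val '' {x : unitInterval | (t : ℝ) - κ ≤ x ∧ x < t} ⊆
        Set.Ico ((t : ℝ) - κ) t := by
      rintro _ ⟨x, hx, rfl⟩
      exact ⟨hx.1, hx.2⟩
    refine (measure_mono hsub).trans_eq ?_
    rw [Real.volume_Ico]
    congr 1
    ring
  have hSi : Integrable fun T : V → unitInterval => softCutoff κ t (T u) * (γ T - ε) := by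
    refine integrable_of_abs_le (c := 1 * 2)
      ((measurable_softCutoff.comp hum).mul (hγm.sub_const ε)) fun T => ?_
    rw [abs_mul, abs_of_nonneg softCutoff_nonneg]
    exact mul_le_mul softCutoff_le_one (hγε T) (abs_nonneg _) zero_le_one
  have hJm : Measurable fun T : V → unitInterval => if T u < t then (1 : ℝ) else 0 :=
    measurable_ite_lt (measurable_pi_apply u) measurable_const
  have hJi : Integrable fun T : V → unitInterval => if T u < t then (1 : ℝ) else 0 :=
    integrable_of_abs_le (c := 1) hJm fun T => by split_ifs <;> simp
  have hJγ : Integrable fun T : V → unitInterval => (if T u < t then (1 : ℝ) else 0) * γ T :=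
    integrable_of_abs_le (c := 1) (hJm.mul hγm) fun T => by
      split_ifs
      · simpa using hγ T
      · simp
  have hI4 : Integrable fun T : V → unitInterval => (if T u < t then (1 : ℝ) else 0) * γ T -
      (if T u < t then (1 : ℝ) else 0) * ε := hJγ.sub (hJi.mul_const ε)
  have step3 : ∫ T : V → unitInterval, softCutoff κ t (T u) * (γ T - ε) ≤
      ∫ T : V → unitInterval, ((if T u < t then (1 : ℝ) else 0) * γ T -
        (if T u < t then (1 : ℝ) else 0) * ε + 2 * K (T u)) := by
    refine integral_mono hSi (hI4.add (hKi.const_mul 2)) fun T => ?_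
    have hb := abs_le.1 (hγε T)
    have hs0 : 0 ≤ softCutoff κ t (T u) := softCutoff_nonneg
    have hs1 : softCutoff κ t (T u) ≤ 1 := softCutoff_le_one
    by_cases h1 : T u < t
    · by_cases h2 : (t : ℝ) - κ ≤ T u
      · simp only [hK, h1, h2, and_self, if_true]
        nlinarith
      · simp only [hK, h1, h2, false_and, if_true, if_false]
        rw [softCutoff_eq_one hκ (not_le.1 h2).le]
        linarith
    · have h3 : (t : ℝ) ≤ T u := not_lt.1 h1
      simp only [hK, h1, and_false, if_false]
      rw [softCutoff_eq_zero hκ h3]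
      simp
  rw [integral_add hI4 (hKi.const_mul 2),
    integral_sub hJγ (hJi.mul_const ε), integral_mul_const, integral_const_mul,
    integral_coord u (g := fun x => if x < t then (1 : ℝ) else 0)
      (Measurable.ite measurableSet_Iio measurable_const measurable_const),
    integral_ite_lt] at step3
  have h0 := hdev (fun k => φ (k / n)) fun k => hφ0 _
  have hY := integral_abs_card_div_sub_le huN hN
  have e1 : 2 / η * volume.real B ≤ 2 * β / η := by
    rw [div_mul_eq_mul_div]
    gcongr
  have e2 : 2 * L * ∫ T : V → unitInterval, |(F T : ℝ) / n - T u| ≤ 2 * L / √n := by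
    rw [← mul_one_div (2 * L)]
    exact mul_le_mul_of_nonneg_left hY (by positivity)
  linarith

end SignalBound

/-! ### A symmetric graph that looks locally like a tree. -/

/-- Words of length at most `r` over an alphabet of `D` letters in which adjacent letters are
different: the vertices of the ball of radius `r` in the `D`-regular tree. -/
abbrev ReducedWord (D r : ℕ) : Type := {l : List (Fin D) // l.IsChain (· ≠ ·) ∧ l.length ≤ r}

instance (D r : ℕ) : Finite (ReducedWord D r) :=
  Set.Finite.subset (List.finite_length_le (Fin D) r) fun _ h => h.2

namespace ReducedWord

variable {D r : ℕ}

/-- The empty word. -/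
def nil : ReducedWord D r := ⟨[], List.isChain_nil, Nat.zero_le _⟩

/-- Crossing the edge of colour `i` in the tree; the leaves without such an edge are fixed. -/
def cross (i : Fin D) (x : ReducedWord D r) : ReducedWord D r :=
  if h : x.1.head? = some i then ⟨x.1.tail, x.2.1.tail, by
    rw [List.length_tail]; exact (Nat.sub_le _ _).trans x.2.2⟩
  else if h' : x.1.length < r then ⟨i :: x.1, List.isChain_cons.2 ⟨fun y hy hiy => h (by
    rw [hiy]; exact hy), x.2.1⟩, h'⟩
  else x

theorem cross_of_head (i : Fin D) (x : ReducedWord D r) (h : x.1.head? = some i) :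
    (cross i x).1 = x.1.tail := by
  rw [cross, dif_pos h]

theorem cross_of_lt (i : Fin D) (x : ReducedWord D r) (h : x.1.head? ≠ some i)
    (h' : x.1.length < r) : (cross i x).1 = i :: x.1 := by
  rw [cross, dif_neg h, dif_pos h']

theorem cross_of_le (i : Fin D) (x : ReducedWord D r) (h : x.1.head? ≠ some i)
    (h' : ¬ x.1.length < r) : cross i x = x := by
  rw [cross, dif_neg h, dif_neg h']

theorem cross_involutive (i : Fin D) : Function.Involutive (cross (r := r) i) := by
  intro x
  by_cases h : x.1.head? = some i
  · obtain ⟨l, hl⟩ := List.head?_eq_some_iff.1 h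
    have h1 : (cross i x).1 = l := by rw [cross_of_head i x h, hl, List.tail_cons]
    have h2 := x.2
    rw [hl] at h2
    have h3 : (cross i x).1.head? ≠ some i := fun h' => by
      rw [h1] at h'
      exact (List.isChain_cons.1 h2.1).1 i h' rfl
    apply Subtype.ext
    rw [cross_of_lt i _ h3 (by rw [h1]; exact h2.2), h1, hl]
  · by_cases h' : x.1.length < r
    · have h1 := cross_of_lt i x h h'
      apply Subtype.ext
      rw [cross_of_head i _ (by rw [h1]; rfl), h1, List.tail_cons]
    · rw [cross_of_le i x h h', cross_of_le i x h h']

/-- Crossing an edge edits only the front of a word. The last letter names the branch at the root,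
and it can change only by passing through the root. -/
theorem getLast?_cross (i : Fin D) (x : ReducedWord D r) (h : x.1 ≠ [])
    (h' : (cross i x).1 ≠ []) : (cross i x).1.getLast? = x.1.getLast? := by
  by_cases h1 : x.1.head? = some i
  · obtain ⟨l, hl⟩ := List.head?_eq_some_iff.1 h1
    rw [cross_of_head i x h1, hl, List.tail_cons] at h' ⊢
    cases l with
    | nil => exact absurd rfl h'
    | cons a l => rw [List.getLast?_cons_cons]
  · by_cases h2 : x.1.length < r
    · rw [cross_of_lt i x h1 h2]
      obtain ⟨a, l, hl⟩ := List.exists_cons_of_ne_nil h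
      rw [hl, List.getLast?_cons_cons]
    · rw [cross_of_le i x h1 h2]

/-- `cross i` as a permutation. -/
def step (i : Fin D) : Equiv.Perm (ReducedWord D r) := (cross_involutive i).toPerm

theorem step_mul_step_mul (i : Fin D) (g : Equiv.Perm (ReducedWord D r)) :
    step i * (step i * g) = g :=
  Equiv.ext fun x => cross_involutive i (g x)

theorem step_nil (hr : 0 < r) (i : Fin D) : ((step i) (nil (r := r))).1 = [i] :=
  cross_of_lt i nil (by simp [nil]) hr

end ReducedWord

open ReducedWord

/-- The Cayley graph generated by the involutions `ReducedWord.step i`. -/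
def wordGraph (D r : ℕ) : SimpleGraph (Equiv.Perm (ReducedWord D r)) where
  Adj g h := g ≠ h ∧ ∃ i, h = step i * g
  symm := ⟨by
    rintro g h ⟨hne, i, rfl⟩
    exact ⟨hne.symm, i, (step_mul_step_mul i g).symm⟩⟩
  loopless := ⟨fun g h => h.1 rfl⟩

theorem isSymmetricNetwork_wordGraph (D r : ℕ) : IsSymmetricNetwork (wordGraph D r) := by
  intro v v'
  refine ⟨⟨Equiv.mulRight (v⁻¹ * v'), ?_⟩, ?_⟩
  · intro g h
    simp [wordGraph, ← mul_assoc]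
  -- Edges are left multiplications, so right multiplications are automorphisms, and these act
  -- transitively.
  · change v * (v⁻¹ * v') = v'
    rw [mul_inv_cancel_left]

/-! ### Tree coordinates around an agent, and descending walks. -/

section Label

variable {D r : ℕ} (v : Equiv.Perm (ReducedWord D r))

/-- The position of `w` in the tree covering the surroundings of `v`. -/
def label (w : Equiv.Perm (ReducedWord D r)) : ReducedWord D r := (w * v⁻¹) nil

theorem label_self : (label v v).1 = [] := by simp [label, nil]

theorem label_step_self (hr : 0 < r) (i : Fin D) : (label v (step i * v)).1 = [i] := by
  have : label v (step i * v) = step i nil := by simp [label]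
  rw [this, step_nil hr]

theorem step_mul_injective (hr : 0 < r) : Function.Injective fun i : Fin D => step i * v := by
  intro i j h
  have h1 := label_step_self v hr i
  rw [show step i * v = step j * v from h, label_step_self v hr j] at h1
  simpa using h1.symm

theorem step_mul_ne (hr : 0 < r) (i : Fin D) : step i * v ≠ v := by
  intro h
  have h1 := label_step_self v hr i
  rw [h, label_self] at h1
  simp at h1

theorem wordGraph_adj_iff (hr : 0 < r) (w : Equiv.Perm (ReducedWord D r)) :
    (wordGraph D r).Adj v w ↔ ∃ i, step i * v = w := by
  constructor
  · rintro ⟨-, i, h⟩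
    exact ⟨i, h.symm⟩
  · rintro ⟨i, rfl⟩
    exact ⟨(step_mul_ne v hr i).symm, i, rfl⟩

/-- The surroundings of `v`, with `v` removed. -/
def branchGraph : SimpleGraph (Equiv.Perm (ReducedWord D r)) where
  Adj a b := (wordGraph D r).Adj a b ∧ (label v a).1 ≠ [] ∧ (label v b).1 ≠ []
  symm := ⟨fun _ _ h => ⟨h.1.symm, h.2.2, h.2.1⟩⟩
  loopless := ⟨fun a h => (wordGraph D r).loopless.irrefl a h.1⟩

theorem branchGraph_adj_getLast? {a b : Equiv.Perm (ReducedWord D r)}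
    (h : (branchGraph v).Adj a b) : (label v a).1.getLast? = (label v b).1.getLast? := by
  obtain ⟨⟨-, i, rfl⟩, ha, hb⟩ := h
  exact (getLast?_cross i _ ha hb).symm

/-- The vertex reached from `v` along a word whose last letter is used first. -/
def walk : List (Fin D) → Equiv.Perm (ReducedWord D r)
  | [] => v
  | i :: l => step i * walk l

/-- Arrival times decrease along the walk from `v` given by a word. -/
def Descending (T : Equiv.Perm (ReducedWord D r) → unitInterval) : List (Fin D) → Prop
  | [] => True
  | i :: l => Descending T l ∧ T (walk v (i :: l)) < T (walk v l)

/-- Some walk of length `r` from `v` is descending. -/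
def HasLongDescent (T : Equiv.Perm (ReducedWord D r) → unitInterval) : Prop :=
  ∃ l : List (Fin D), l.length = r ∧ Descending v T l

variable {v} {T : Equiv.Perm (ReducedWord D r) → unitInterval}

theorem Descending.drop {l : List (Fin D)} (h : Descending v T l) (k : ℕ) :
    Descending v T (l.drop k) := by
  induction l generalizing k with
  | nil => simpa using h
  | cons i l ih =>
    cases k with
    | zero => simpa using h
    | succ k => simpa using ih h.1 k

/-- A descending walk cannot backtrack, since recrossing the last edge would return to a later
arrival time. Its word is therefore reduced, and the label records it letter by letter until length
`r`. -/
theorem Descending.label_walk {l : List (Fin D)} (h : Descending v T l) (hl : l.length ≤ r) :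
    (label v (walk v l)).1 = l := by
  induction l with
  | nil => exact label_self v
  | cons i l ih =>
    have hl' : l.length < r := hl
    have h1 := ih h.1 hl'.le
    have h2 : (label v (walk v l)).1.head? ≠ some i := by
      rw [h1]
      intro h2
      obtain ⟨l', rfl⟩ := List.head?_eq_some_iff.1 h2
      have h3 : T (walk v l') < T (walk v (i :: l')) := by
        have := h.2
        simp only [walk, step_mul_step_mul] at this
        exact this
      exact lt_asymm h3 h.1.2
    have h3 := cross_of_lt i _ h2 (by rw [h1]; exact hl')
    rw [h1] at h3
    exact h3

theorem Descending.length_lt {l : List (Fin D)} (h : Descending v T l)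
    (hT : ¬ HasLongDescent v T) : l.length < r := by
  by_contra hl
  -- The last letter is used first, so dropping letters at the front keeps the initial `r` steps of
  -- the walk.
  refine hT ⟨l.drop (l.length - r), ?_, h.drop _⟩
  rw [List.length_drop]
  omega

theorem orderInvariant_descending (l : List (Fin D)) :
    OrderInvariant fun T => Descending v T l := by
  intro T T' h
  induction l with
  | nil => rfl
  | cons i l ih => simp only [Descending, h]; rw [show Descending v T l = _ from ih]

theorem orderInvariant_hasLongDescent : OrderInvariant (HasLongDescent v) := by
  intro T T' h
  simp only [HasLongDescent]
  exact propext (exists_congr fun l => and_congr_right fun _ =>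
    iff_of_eq (orderInvariant_descending (v := v) l T T' h))

/-- The suffixes of `l` have lengths `0` to `r`, so the walk visits `r + 1` vertices; hence the
factorial of `r + 1` below. -/
theorem Descending.strictAnti {l : List (Fin D)} (hl : l.length = r) (h : Descending v T l) :
    StrictAnti (T ∘ fun j : Fin (r + 1) => walk v (l.drop (r - j))) := by
  refine Fin.strictAnti_iff_succ_lt.2 fun i => ?_
  have hi := i.2
  have h1 : r - (i.succ : ℕ) < l.length := by simp; omega
  have h2 := List.drop_eq_getElem_cons h1
  have h3 : r - (i.succ : ℕ) + 1 = r - (i.castSucc : ℕ) := by simp; omega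
  rw [h3] at h2
  have h4 := h.drop (r - (i.succ : ℕ))
  simp only [Function.comp_apply]
  rw [h2] at h4 ⊢
  exact h4.2

variable [Fintype (Equiv.Perm (ReducedWord D r))]

theorem measurableSet_hasLongDescent : MeasurableSet {T | HasLongDescent v T} :=
  measurableSet_setOfPred.2 orderInvariant_hasLongDescent.measurable

/-- Long descending walks are unlikely. -/
theorem measureReal_hasLongDescent_le :
    volume.real {T | HasLongDescent v T} ≤ (D : ℝ) ^ r / ((r + 1).factorial : ℝ) := by
  classical
  have hsub : {T | HasLongDescent v T} ⊆
      ⋃ f ∈ (Finset.univ : Finset (Fin r → Fin D)), {T | Descending v T (List.ofFn f)} := by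
    rintro T ⟨l, hl, h⟩
    subst hl
    simp only [Finset.mem_univ, Set.iUnion_true, Set.mem_iUnion]
    exact ⟨l.get, by simpa using h⟩
  have hone : ∀ f : Fin r → Fin D, volume.real {T | Descending v T (List.ofFn f)} ≤
      1 / ((r + 1).factorial : ℝ) := by
    intro f
    have hl : (List.ofFn f).length = r := List.length_ofFn
    -- A walk that revisits a vertex cannot be descending, so only injective walks contribute.
    by_cases hinj : Function.Injective fun j : Fin (r + 1) => walk v ((List.ofFn f).drop (r - j))
    · refine le_trans (measureReal_mono ?_) (measureReal_strictAnti_le ⟨_, hinj⟩)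
      exact fun T h => Descending.strictAnti hl h
    · have : {T | Descending v T (List.ofFn f)} = ∅ := by
        rw [Set.eq_empty_iff_forall_notMem]
        exact fun T h => hinj (Function.Injective.of_comp (Descending.strictAnti hl h).injective)
      rw [this, measureReal_empty]
      positivity
  refine (measureReal_mono hsub (measure_ne_top _ _)).trans ((measureReal_biUnion_finset_le _ _).trans
    ((Finset.sum_le_sum fun f _ => hone f).trans_eq ?_))
  simp
  rfl

end Label

/-! ### Dependence on the visible agents only, and scores of actions. -/

section Locality

variable {V : Type*} [Fintype V] [DecidableEq V]

/-- The joint law of a set of agents that see only each other depends only on what they see. -/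
theorem condMean_congr {G₁ G₂ : SimpleGraph V} (p : ℝ) {σ₁ σ₂ : V → Strategy V}
    {T₁ T₂ : V → unitInterval} (θ : Bool) (C : Finset V) {f : (V → Bool × Bool) → ℝ}
    (hf : DependsOnlyOn C f) (hσ : ∀ w ∈ C, σ₁ w = σ₂ w)
    (hC : ∀ w ∈ C, ∀ u, G₁.Adj w u → T₁ u < T₁ w → u ∈ C)
    (hadj : ∀ w ∈ C, ∀ u, (G₁.Adj w u ∧ T₁ u < T₁ w) ↔ (G₂.Adj w u ∧ T₂ u < T₂ w)) :
    condMean G₁ p σ₁ T₁ θ f = condMean G₂ p σ₂ T₂ θ f := by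
  refine (isCausal_game G₁ p σ₁ T₁ θ).sum_prod_mul_congr (isCausal_game G₂ p σ₂ T₂ θ) C hf ?_ ?_
  · intro w hw z z' h
    simp only [kernel, h w hw]
    rw [info_congr G₁ w T₁ (s := fun u => (z u).1) (s' := fun u => (z' u).1)
      (congrArg Prod.fst (h w hw)) fun u hu hT => congrArg Prod.snd (h u (hC w hw u hu hT))]
  · intro w hw z
    have : info G₁ w T₁ (fun u => (z u).1) (fun u => (z u).2) =
        info G₂ w T₂ (fun u => (z u).1) (fun u => (z u).2) := by
      refine Prod.ext rfl (funext fun u => ?_)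
      simp only [info]
      by_cases h : G₁.Adj w u ∧ T₁ u < T₁ w
      · rw [if_pos h, if_pos ((hadj w hw u).1 h)]
      · rw [if_neg h, if_neg fun h' => h ((hadj w hw u).2 h')]
    simp only [kernel, hσ w hw, this]

/-- `C` is a union of connected components, so no agent sees across its boundary and both sides have
self-contained kernels. -/
theorem condMean_mul_of_closed {G : SimpleGraph V} (p : ℝ) (σ : V → Strategy V)
    (T : V → unitInterval) (θ : Bool) {C : Finset V} (hC : ∀ w u, G.Adj w u → (w ∈ C ↔ u ∈ C))
    {f g : (V → Bool × Bool) → ℝ} (hf : DependsOnlyOn C f) (hg : DependsOnlyOn Cᶜ g) :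
    condMean G p σ T θ (fun z => f z * g z) = condMean G p σ T θ f * condMean G p σ T θ g := by
  refine (isCausal_game G p σ T θ).sum_prod_mul_mul C Cᶜ (fun w => Finset.mem_compl) hf hg ?_ ?_
  · intro w hw z z' h
    simp only [kernel, h w hw]
    rw [info_congr G w T (s := fun u => (z u).1) (s' := fun u => (z' u).1)
      (congrArg Prod.fst (h w hw)) fun u hu _ => congrArg Prod.snd (h u ((hC w u hu).1 hw))]
  · intro w hw z z' h
    simp only [kernel, h w hw]
    rw [info_congr G w T (s := fun u => (z u).1) (s' := fun u => (z' u).1)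
      (congrArg Prod.fst (h w hw)) fun u hu _ => congrArg Prod.snd (h u (by
        rw [Finset.mem_compl, ← hC w u hu]; exact Finset.mem_compl.1 hw))]

/-- `1` for the correct action and `-1` for the wrong one. -/
def score (θ b : Bool) : ℝ := if b = θ then 1 else -1

theorem score_mul_self (θ b : Bool) : score θ b * score θ b = 1 := by
  simp only [score]; split_ifs <;> simp

/-- The expected score of `u` given arrival times and state. -/
noncomputable def meanScore (G : SimpleGraph V) (p : ℝ) (σ : V → Strategy V) (u : V) (θ : Bool)
    (T : V → unitInterval) : ℝ :=
  condMean G p σ T θ fun z => score θ (z u).2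

theorem meanScore_eq (G : SimpleGraph V) (p : ℝ) (σ : V → Strategy V) (u : V) (θ : Bool)
    (T : V → unitInterval) : meanScore G p σ u θ T = 2 * correct G p σ u T θ - 1 := by
  rw [correct, ← condMean_const_mul, sub_eq_add_neg, ← condMean_const G p σ T θ (-1),
    ← condMean_add, meanScore]
  congr 1
  funext z
  simp only [score]
  split_ifs <;> norm_num

theorem abs_meanScore_le (G : SimpleGraph V) {p : ℝ} (hp : 0 ≤ p) (hp' : p ≤ 1)
    (σ : V → Strategy V) (u : V) (θ : Bool) (T : V → unitInterval) :
    |meanScore G p σ u θ T| ≤ 1 := by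
  have h0 := correct_nonneg G hp hp' σ u T θ
  have h1 := correct_le_one G hp hp' σ u T θ
  rw [meanScore_eq, abs_le]
  constructor <;> linarith

theorem orderInvariant_meanScore (G : SimpleGraph V) (p : ℝ) (σ : V → Strategy V) (u : V)
    (θ : Bool) : OrderInvariant (meanScore G p σ u θ) :=
  orderInvariant_condMean G p σ θ _

end Locality

/-! ### Independence of the neighbours, and Chebyshev's inequality. -/

section Branches

variable {D r : ℕ} [Fintype (Equiv.Perm (ReducedWord D r))]
  [DecidableEq (Equiv.Perm (ReducedWord D r))] (v : Equiv.Perm (ReducedWord D r))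

/-- The vertices of the surroundings of `v` that lie behind the neighbour `step i * v`. -/
def branch (i : Fin D) : Finset (Equiv.Perm (ReducedWord D r)) :=
  {w | (label v w).1.getLast? = some i}

theorem mem_branch {i : Fin D} {w : Equiv.Perm (ReducedWord D r)} :
    w ∈ branch v i ↔ (label v w).1.getLast? = some i := by
  simp [branch]

theorem step_mul_mem_branch (hr : 0 < r) (i : Fin D) : step i * v ∈ branch v i := by
  rw [mem_branch, label_step_self v hr]; rfl

theorem disjoint_branch {i j : Fin D} (h : i ≠ j) : Disjoint (branch v i) (branch v j) := by
  rw [Finset.disjoint_left]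
  intro w hi hj
  rw [mem_branch] at hi hj
  exact h (Option.some_injective _ (hi.symm.trans hj))

theorem branch_closed (i : Fin D) (w u : Equiv.Perm (ReducedWord D r))
    (h : (branchGraph v).Adj w u) : w ∈ branch v i ↔ u ∈ branch v i := by
  rw [mem_branch, mem_branch, branchGraph_adj_getLast? v h]

open Classical in
/-- The vertices that can be reached from `v` along a non-trivial descending walk. -/
noncomputable def descentSet (T : Equiv.Perm (ReducedWord D r) → unitInterval) :
    Finset (Equiv.Perm (ReducedWord D r)) :=
  {w | ∃ l ≠ [], Descending v T l ∧ walk v l = w}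

variable {v} {T : Equiv.Perm (ReducedWord D r) → unitInterval}

theorem mem_descentSet {w : Equiv.Perm (ReducedWord D r)} :
    w ∈ descentSet v T ↔ ∃ l ≠ [], Descending v T l ∧ walk v l = w := by
  simp [descentSet]

theorem step_mul_mem_descentSet {i : Fin D} (h : T (step i * v) < T v) :
    step i * v ∈ descentSet v T :=
  mem_descentSet.2 ⟨[i], by simp, ⟨trivial, h⟩, rfl⟩

/-- Short descending walks are recorded by their labels, so none of them meets a vertex deleted in
`branchGraph v`, and in particular none returns to `v`. -/
theorem label_ne_nil_of_mem_descentSet (hT : ¬ HasLongDescent v T)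
    {w : Equiv.Perm (ReducedWord D r)} (hw : w ∈ descentSet v T) : (label v w).1 ≠ [] := by
  obtain ⟨l, hl, hd, rfl⟩ := mem_descentSet.1 hw
  rwa [hd.label_walk (hd.length_lt hT).le]

theorem descentSet_closed {w u : Equiv.Perm (ReducedWord D r)} (hw : w ∈ descentSet v T)
    (h : (wordGraph D r).Adj w u) (hu : T u < T w) : u ∈ descentSet v T := by
  obtain ⟨l, hl, hd, rfl⟩ := mem_descentSet.1 hw
  obtain ⟨-, i, rfl⟩ := h
  exact mem_descentSet.2 ⟨i :: l, by simp, ⟨hd, hu⟩, rfl⟩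

/-- Without long descending walks from `v`, the agents that matter for the information of `v` behave
as in the surroundings of `v`. -/
theorem condMean_wordGraph_eq (hT : ¬ HasLongDescent v T) (p : ℝ)
    {σ σ' : Equiv.Perm (ReducedWord D r) → Strategy (Equiv.Perm (ReducedWord D r))}
    (hσ : ∀ w ≠ v, σ w = σ' w) (θ : Bool)
    {f : (Equiv.Perm (ReducedWord D r) → Bool × Bool) → ℝ}
    (hf : DependsOnlyOn (descentSet v T) f) :
    condMean (wordGraph D r) p σ T θ f = condMean (branchGraph v) p σ' T θ f := by
  refine condMean_congr p θ (descentSet v T) hf ?_ (fun w hw u h hu => descentSet_closed hw h hu) ?_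
  · intro w hw
    refine hσ w ?_
    rintro rfl
    exact label_ne_nil_of_mem_descentSet hT hw (label_self w)
  · intro w hw u
    refine ⟨fun h => ⟨⟨h.1, label_ne_nil_of_mem_descentSet hT hw,
      label_ne_nil_of_mem_descentSet hT (descentSet_closed hw h.1 h.2)⟩, h.2⟩,
      fun h => ⟨h.1.1, h.2⟩⟩

variable (v) (p : ℝ)
  (σ : Equiv.Perm (ReducedWord D r) → Strategy (Equiv.Perm (ReducedWord D r))) (θ : Bool)

/-- `v` is isolated in `branchGraph v`, so his arrival time influences nobody else; it can therefore
be integrated separately from the scores. -/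
theorem condMean_branchGraph_update (T : Equiv.Perm (ReducedWord D r) → unitInterval)
    (t : unitInterval) (f : (Equiv.Perm (ReducedWord D r) → Bool × Bool) → ℝ) :
    condMean (branchGraph v) p σ (Function.update T v t) θ f =
      condMean (branchGraph v) p σ T θ f := by
  refine condMean_congr p θ Finset.univ (fun z z' h => ?_) (fun _ _ => rfl)
    (fun _ _ _ _ _ => Finset.mem_univ _) fun w _ u => and_congr_right fun h => ?_
  · rw [funext fun w => h w (Finset.mem_univ w)]
  · have hw : w ≠ v := by rintro rfl; exact h.2.1 (label_self w)
    have hu : u ≠ v := by rintro rfl; exact h.2.2 (label_self u)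
    rw [Function.update_of_ne hw, Function.update_of_ne hu]

/-- Independence is needed twice: of actions given `T`, as in `condMean_score_mul_score`, and of
these conditional means as functions of `T`, which rests on this lemma. -/
theorem dependsOnlyOn_meanScore (hr : 0 < r) (i : Fin D) :
    DependsOnlyOn (branch v i) (meanScore (branchGraph v) p σ (step i * v) θ) := by
  intro T T' h
  refine condMean_congr p θ (branch v i) (fun z z' hz => ?_) (fun _ _ => rfl)
    (fun w hw u hu _ => (branch_closed v i w u hu).1 hw) fun w hw u => and_congr_right fun hu => ?_
  · rw [hz _ (step_mul_mem_branch v hr i)]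
  · rw [h w hw, h u ((branch_closed v i w u hu).1 hw)]

theorem condMean_score_mul_score (hr : 0 < r) {i j : Fin D} (hij : i ≠ j)
    (T : Equiv.Perm (ReducedWord D r) → unitInterval) :
    condMean (branchGraph v) p σ T θ
      (fun z => score θ (z (step i * v)).2 * score θ (z (step j * v)).2) =
    meanScore (branchGraph v) p σ (step i * v) θ T *
      meanScore (branchGraph v) p σ (step j * v) θ T := by
  refine condMean_mul_of_closed p σ T θ (C := branch v i) (branch_closed v i)
    (fun z z' hz => ?_) fun z z' hz => ?_
  · rw [hz _ (step_mul_mem_branch v hr i)]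
  · rw [hz (step j * v) (Finset.mem_compl.2
      (Finset.disjoint_right.1 (disjoint_branch v hij) (step_mul_mem_branch v hr j)))]

/-- The total score of the neighbours of `v` who arrive before time `t`. -/
noncomputable def totalScore (t : unitInterval)
    (T : Equiv.Perm (ReducedWord D r) → unitInterval)
    (z : Equiv.Perm (ReducedWord D r) → Bool × Bool) : ℝ :=
  ∑ i : Fin D, (if T (step i * v) < t then (1 : ℝ) else 0) * score θ (z (step i * v)).2

variable {p}

/-- Chebyshev's inequality for the total score in the surroundings of `v`. -/
theorem integral_totalScore_nonpos_le (hp : 0 ≤ p) (hp' : p ≤ 1) (hr : 0 < r) (hD : 0 < D)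
    (t : unitInterval) {m : ℝ} (hm : 0 < m)
    (hmean : ∀ i : Fin D, m ≤ ∫ T, (if T (step i * v) < t then (1 : ℝ) else 0) *
      meanScore (branchGraph v) p σ (step i * v) θ T) :
    ∫ T, condMean (branchGraph v) p σ T θ
      (fun z => if totalScore v θ t T z ≤ 0 then 1 else 0) ≤ 1 / (D * m ^ 2) := by
  set u : Fin D → Equiv.Perm (ReducedWord D r) := fun i => step i * v with hu
  set J : Fin D → (Equiv.Perm (ReducedWord D r) → unitInterval) → ℝ :=
    fun i T => if T (u i) < t then (1 : ℝ) else 0 with hJ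
  set g : Fin D → (Equiv.Perm (ReducedWord D r) → unitInterval) → ℝ :=
    fun i T => J i T * meanScore (branchGraph v) p σ (u i) θ T with hg
  have hJ01 : ∀ i T, 0 ≤ J i T ∧ J i T ≤ 1 := fun i T => by
    simp only [hJ]; split_ifs <;> norm_num
  have hgm : ∀ i, Measurable (g i) := fun i =>
    (measurable_ite_lt (measurable_pi_apply _) measurable_const).mul
      (orderInvariant_meanScore _ _ _ _ _).measurable
  have hgb : ∀ i T, |g i T| ≤ 1 := fun i T => by
    rw [abs_mul, abs_of_nonneg (hJ01 i T).1]
    exact mul_le_one₀ (hJ01 i T).2 (abs_nonneg _) (abs_meanScore_le _ hp hp' _ _ _ _)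
  have hgdep : ∀ i, DependsOnlyOn (branch v i) (g i) := fun i T T' h => by
    simp only [hg, hJ]
    rw [h (u i) (step_mul_mem_branch v hr i), dependsOnlyOn_meanScore v p σ θ hr i T T' h]
  set M : Fin D → ℝ := fun i => ∫ T, g i T with hM
  obtain ⟨S, hS⟩ : ∃ S, S = ∑ i, M i := ⟨_, rfl⟩
  have hSm : D * m ≤ S := by
    have : ∑ _i : Fin D, m ≤ S := hS ▸ Finset.sum_le_sum fun i _ => hmean i
    simpa using this
  have hDpos : (0 : ℝ) < D := by exact_mod_cast hD
  have hS0 : 0 < S := lt_of_lt_of_le (by positivity) hSm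
  have hgi : ∀ i, Integrable (g i) := fun i => integrable_of_abs_le (hgm i) (hgb i)
  have hggi : ∀ i j, Integrable fun T => g i T * g j T := fun i j =>
    integrable_of_abs_le (c := 1) ((hgm i).mul (hgm j)) fun T => by
      rw [abs_mul]; exact mul_le_one₀ (hgb i T) (abs_nonneg _) (hgb j T)
  have hgg : ∀ i j, i ≠ j → ∫ T, g i T * g j T = M i * M j := fun i j hij =>
    integral_mul_of_dependsOnlyOn (disjoint_branch v hij) (hgdep i) (hgdep j) (hgm i) (hgm j)
  -- An upper bound for the conditional mean of `(totalScore - S) ^ 2` given `T`, with each diagonal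
  -- term bounded by 1. After integration the off-diagonal terms are at most `S ^ 2` minus the
  -- diagonal squares, so only `D` survives.
  let Q : (Equiv.Perm (ReducedWord D r) → unitInterval) → ℝ := fun T =>
    (∑ i, ∑ j, if i = j then 1 else g i T * g j T) - 2 * S * (∑ i, g i T) + S ^ 2
  have hQi1 : ∀ i j, Integrable fun T => if i = j then (1 : ℝ) else g i T * g j T := fun i j => by
    split_ifs
    · exact integrable_const _
    · exact hggi i j
  have hQi2 : Integrable fun T => ∑ i, ∑ j, if i = j then (1 : ℝ) else g i T * g j T :=
    integrable_finsetSum _ fun i _ => integrable_finsetSum _ fun j _ => hQi1 i j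
  have hQi3 : Integrable fun T => ∑ i, g i T := integrable_finsetSum _ fun i _ => hgi i
  have hQi4 : Integrable fun T =>
      (∑ i, ∑ j, if i = j then (1 : ℝ) else g i T * g j T) - 2 * S * (∑ i, g i T) :=
    hQi2.sub (hQi3.const_mul _)
  have hQint : ∫ T, Q T ≤ D := by
    have h1 : ∫ T, Q T = (∑ i, ∑ j, if i = j then (1 : ℝ) else M i * M j) - 2 * S * S + S ^ 2 := by
      simp only [Q]
      rw [integral_add hQi4 (integrable_const _), integral_sub hQi2 (hQi3.const_mul _),
        integral_const_mul, integral_finsetSum _ fun i _ => hgi i,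
        integral_finsetSum _ fun i _ => integrable_finsetSum _ fun j _ => hQi1 i j]
      simp only [integral_const, probReal_univ, one_smul]
      rw [show ∑ i, ∫ T, g i T = S from hS.symm]
      congr 2
      refine Finset.sum_congr rfl fun i _ => ?_
      rw [integral_finsetSum _ fun j _ => hQi1 i j]
      refine Finset.sum_congr rfl fun j _ => ?_
      split_ifs with h
      · simp
      · exact hgg i j h
    have h2 : (∑ i, ∑ j, if i = j then (1 : ℝ) else M i * M j) ≤
        ∑ i, ∑ j, ((if i = j then (1 : ℝ) else 0) + M i * M j) := by
      refine Finset.sum_le_sum fun i _ => Finset.sum_le_sum fun j _ => ?_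
      split_ifs with h
      · subst h; nlinarith [sq_nonneg (M i)]
      · simp
    have h3 : ∑ i, ∑ j, ((if i = j then (1 : ℝ) else 0) + M i * M j) = D + S * S := by
      simp only [Finset.sum_add_distrib, ← Finset.mul_sum, ← Finset.sum_mul]
      simp [hS]
    rw [h1]
    nlinarith
  have hpt : ∀ T, condMean (branchGraph v) p σ T θ
      (fun z => if totalScore v θ t T z ≤ 0 then 1 else 0) ≤ 1 / S ^ 2 * Q T := by
    intro T
    -- Where the total score is nonpositive it deviates from `S` by at least `S`.
    have h1 : ∀ z, (if totalScore v θ t T z ≤ 0 then (1 : ℝ) else 0) ≤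
        1 / S ^ 2 * ((∑ i, ∑ j, J i T * J j T * (score θ (z (u i)).2 * score θ (z (u j)).2)) +
          ((∑ i, -2 * S * J i T * score θ (z (u i)).2) + S ^ 2)) := by
      intro z
      have e : (∑ i, ∑ j, J i T * J j T * (score θ (z (u i)).2 * score θ (z (u j)).2)) +
          ((∑ i, -2 * S * J i T * score θ (z (u i)).2) + S ^ 2) =
          (totalScore v θ t T z - S) ^ 2 := by
        have e1 : (∑ i, ∑ j, J i T * J j T * (score θ (z (u i)).2 * score θ (z (u j)).2)) =
            totalScore v θ t T z * totalScore v θ t T z := by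
          simp only [totalScore]
          rw [Finset.sum_mul_sum]
          exact Finset.sum_congr rfl fun i _ => Finset.sum_congr rfl fun j _ => by
            simp only [hJ, hu]; ring
        have e2 : (∑ i, -2 * S * J i T * score θ (z (u i)).2) =
            -2 * S * totalScore v θ t T z := by
          simp only [totalScore]
          rw [Finset.mul_sum]
          exact Finset.sum_congr rfl fun i _ => by simp only [hJ, hu]; ring
        rw [e1, e2]; ring
      rw [e, one_div_mul_eq_div]
      split_ifs with h
      · rw [le_div_iff₀ (by positivity)]
        nlinarith
      · positivity
    refine (condMean_mono _ hp hp' σ T θ h1).trans ?_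
    rw [condMean_const_mul, condMean_add, condMean_add, condMean_const, condMean_sum, condMean_sum]
    refine mul_le_mul_of_nonneg_left ?_ (by positivity)
    have h2 : ∑ i, condMean (branchGraph v) p σ T θ (fun z => -2 * S * J i T * score θ (z (u i)).2) =
        -(2 * S * ∑ i, g i T) := by
      rw [Finset.mul_sum, ← Finset.sum_neg_distrib]
      refine Finset.sum_congr rfl fun i _ => ?_
      rw [condMean_const_mul]
      simp only [hg, meanScore]
      ring
    have h3 : ∑ i, condMean (branchGraph v) p σ T θ (fun z =>
        ∑ j, J i T * J j T * (score θ (z (u i)).2 * score θ (z (u j)).2)) ≤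
        ∑ i, ∑ j, if i = j then 1 else g i T * g j T := by
      refine Finset.sum_le_sum fun i _ => ?_
      rw [condMean_sum]
      refine Finset.sum_le_sum fun j _ => ?_
      rw [condMean_const_mul]
      split_ifs with h
      · subst h
        simp only [score_mul_self, condMean_const, mul_one]
        exact mul_le_one₀ (hJ01 i T).2 (hJ01 i T).1 (hJ01 i T).2
      · rw [condMean_score_mul_score v p σ θ hr h]
        simp only [hg]
        exact le_of_eq (by ring)
    simp only [Q]
    linarith
  calc _ ≤ ∫ T, 1 / S ^ 2 * Q T := by
        refine integral_mono_of_nonneg (ae_of_all _ fun T => ?_)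
          ((hQi4.add (integrable_const _)).const_mul _) (ae_of_all _ hpt)
        exact condMean_nonneg _ hp hp' σ T θ fun z => by split_ifs <;> norm_num
    _ = 1 / S ^ 2 * ∫ T, Q T := integral_const_mul _ _
    _ ≤ 1 / (D * m) ^ 2 * D := by
        refine mul_le_mul ?_ hQint ?_ (by positivity)
        · exact one_div_le_one_div_of_le (by positivity) (pow_le_pow_left₀ (by positivity) hSm 2)
        · refine integral_nonneg fun T => ?_
          have h0 : 0 ≤ 1 / S ^ 2 * Q T := by
            refine le_trans ?_ (hpt T)
            exact condMean_nonneg _ hp hp' σ T θ fun z => by split_ifs <;> norm_num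
          exact nonneg_of_mul_nonneg_right h0 (by positivity)
    _ = 1 / (D * m ^ 2) := by field_simp

end Branches

/-! ### Following the majority of the earlier friends. -/

section Majority

variable {D r : ℕ} [Fintype (Equiv.Perm (ReducedWord D r))]
  [DecidableEq (Equiv.Perm (ReducedWord D r))] (v : Equiv.Perm (ReducedWord D r))
  {p : ℝ} {σ : Equiv.Perm (ReducedWord D r) → Strategy (Equiv.Perm (ReducedWord D r))}

/-- The neighbours of a vertex of the word graph. -/
def neighbours (u : Equiv.Perm (ReducedWord D r)) : Finset (Equiv.Perm (ReducedWord D r)) :=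
  Finset.univ.image fun i => step i * u

theorem card_neighbours (hr : 0 < r) (u : Equiv.Perm (ReducedWord D r)) :
    (neighbours u).card = D := by
  rw [neighbours, Finset.card_image_of_injective _ (step_mul_injective u hr), Finset.card_fin]

theorem mem_neighbours (hr : 0 < r) {u w : Equiv.Perm (ReducedWord D r)} :
    w ∈ neighbours u ↔ (wordGraph D r).Adj u w := by
  rw [wordGraph_adj_iff u hr, neighbours]
  simp

theorem seen_wordGraph (hr : 0 < r) (u : Equiv.Perm (ReducedWord D r))
    (T : Equiv.Perm (ReducedWord D r) → unitInterval) :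
    seen (wordGraph D r) u T = (neighbours u).filter fun w => T w < T u := by
  ext w
  simp [seen, mem_neighbours hr]

/-- In a state-symmetric equilibrium, in the surroundings of `v`, the neighbours of `v` who arrive
before a given time have an average score that is bounded below. -/
theorem IsEquilibrium.integral_meanScore_ge (hp : 1 / 2 ≤ p) (hp' : p ≤ 1) (hr : 0 < r)
    (hD : 0 < D) (h : IsEquilibrium (wordGraph D r) p σ)
    (hs : IsStateSymmetric (wordGraph D r) p σ) (θ : Bool) (i : Fin D) {η κ : ℝ} (hη : 0 < η)
    (hκ : 0 < κ) {t : unitInterval} (ht : (t : ℝ) ≤ 1 - η) :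
    (2 * p - 1) * t - 2 * κ - 2 * ((D : ℝ) ^ r / ((r + 1).factorial : ℝ)) / η -
        2 * (1 / (κ * η) + 1 / η ^ 2) / √D ≤
      ∫ T, (if T (step i * v) < t then (1 : ℝ) else 0) *
        meanScore (branchGraph v) p σ (step i * v) θ T := by
  have hp0 : 0 ≤ p := by linarith
  set u := step i * v with hu
  have huv : u ≠ v := step_mul_ne v hr i
  have hadj : (wordGraph D r).Adj u v := ((wordGraph_adj_iff v hr u).2 ⟨i, rfl⟩).symm
  have key := integral_before_ge (N := neighbours u)
    (Γ := meanScore (wordGraph D r) p σ u θ) (γ := meanScore (branchGraph v) p σ u θ)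
    (ε := 2 * p - 1) (B := {T | HasLongDescent v T}) huv
    (fun h' => (wordGraph D r).loopless.irrefl u ((mem_neighbours hr).1 h'))
    (by rwa [card_neighbours hr]) (orderInvariant_meanScore _ _ _ _ _).measurable
    (orderInvariant_meanScore _ _ _ _ _).measurable (abs_meanScore_le _ hp0 hp' σ u θ)
    (abs_meanScore_le _ hp0 hp' σ u θ) (by linarith) (by linarith) measurableSet_hasLongDescent
    measureReal_hasLongDescent_le ?_ ?_ ?_ hη hκ ht
  · rwa [card_neighbours hr] at key
  · intro c hc
    -- Weight zero when `v` is seen keeps only the event that `u` precedes `v`. This is legitimate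
    -- because `u` observes whether it holds.
    have h1 := h.integral_mul_correct hp0 hp' hs u
      (c := fun S => if v ∈ S then 0 else c S.card) (fun S => by
        split_ifs
        · exact le_rfl
        · exact hc _) θ
    refine (mul_nonneg zero_le_two h1).trans_eq ?_
    rw [← integral_const_mul]
    refine integral_congr_ae ?_
    -- Not seeing `v` means `T u ≤ T v`; ties are discarded as a null event.
    filter_upwards [ae_ne_of_ne huv] with T hT
    have h2 : v ∈ seen (wordGraph D r) u T ↔ T v < T u := by
      simp [seen, hadj]
    rw [meanScore_eq]
    simp only [h2]
    rw [seen_wordGraph hr]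
    by_cases h3 : T v < T u
    · rw [if_pos h3, if_neg h3.not_gt]; ring
    · rw [if_neg h3, if_pos (lt_of_le_of_ne (not_lt.1 h3) hT)]; ring
  · intro T hT hB
    refine condMean_wordGraph_eq hB p (fun _ _ => rfl) θ fun z z' hz => ?_
    rw [hz u (step_mul_mem_descentSet hT)]
  · intro T t'
    exact condMean_branchGraph_update v p σ θ T t' _

open Classical in
/-- The strategy of `v` that follows the majority of the earlier friends. -/
noncomputable def majority : Strategy (Equiv.Perm (ReducedWord D r)) := fun I =>
  if 0 < ∑ i : Fin D, (I.2 (step i * v)).elim 0 (score true) then PMF.pure true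
  else PMF.pure false

theorem majority_info (hr : 0 < r) (T : Equiv.Perm (ReducedWord D r) → unitInterval) (θ : Bool)
    (z : Equiv.Perm (ReducedWord D r) → Bool × Bool) (hz : 0 < totalScore v θ (T v) T z) :
    majority v (info (wordGraph D r) v T (fun u => (z u).1) fun u => (z u).2) = PMF.pure θ := by
  have h1 : ∑ i : Fin D, ((info (wordGraph D r) v T (fun u => (z u).1) fun u => (z u).2).2
      (step i * v)).elim 0 (score true) = totalScore v true (T v) T z := by
    refine Finset.sum_congr rfl fun i _ => ?_
    have hadj : (wordGraph D r).Adj v (step i * v) := (wordGraph_adj_iff v hr _).2 ⟨i, rfl⟩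
    simp only [info, hadj, true_and]
    split_ifs <;> simp
  have h2 : totalScore v false (T v) T z = - totalScore v true (T v) T z := by
    simp only [totalScore, ← Finset.sum_neg_distrib]
    refine Finset.sum_congr rfl fun i _ => ?_
    cases h : (z (step i * v)).2 <;> simp [score]
  rw [majority, h1]
  cases θ
  · rw [if_neg (by linarith)]
  · rw [if_pos hz]

theorem correct_majority_ge (hp : 0 ≤ p) (hp' : p ≤ 1) (hr : 0 < r)
    {T : Equiv.Perm (ReducedWord D r) → unitInterval} (hT : ¬ HasLongDescent v T) (θ : Bool) :
    1 - condMean (branchGraph v) p σ T θ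
        (fun z => if totalScore v θ (T v) T z ≤ 0 then 1 else 0) ≤
      correct (wordGraph D r) p (Function.update σ v (majority v)) v T θ := by
  set σ' := Function.update σ v (majority v) with hσ'
  rw [← condMean_wordGraph_eq (σ := σ') hT p (fun w hw => Function.update_of_ne hw _ _) θ,
    sub_le_iff_le_add, correct, ← condMean_add]
  · refine (condMean_const (wordGraph D r) p σ' T θ 1).symm.trans_le
      (Finset.sum_le_sum fun z _ => ?_)
    beta_reduce
    have hnn : 0 ≤ ∏ w, kernel (wordGraph D r) (fun _ => signalWeight p θ) σ' T w z :=
      Finset.prod_nonneg fun w _ => kernel_nonneg _ hp hp' σ' T θ w z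
    by_cases h1 : totalScore v θ (T v) T z ≤ 0
    · refine mul_le_mul_of_nonneg_left ?_ hnn
      rw [if_pos h1]
      split_ifs <;> norm_num
    · by_cases h2 : (z v).2 = θ
      · rw [if_neg h1, if_pos h2, add_zero]
      · have h3 : kernel (wordGraph D r) (fun _ => signalWeight p θ) σ' T v z = 0 := by
          rw [kernel, hσ', Function.update_self, majority_info v hr T θ z (not_le.1 h1),
            PMF.pure_apply, if_neg h2]
          simp
        rw [Finset.prod_eq_zero (Finset.mem_univ v) h3, zero_mul, zero_mul]
  · intro z z' hz
    have : totalScore v θ (T v) T z = totalScore v θ (T v) T z' := by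
      refine Finset.sum_congr rfl fun i _ => ?_
      split_ifs with h
      · rw [hz _ (step_mul_mem_descentSet h)]
      · simp
    simp only [this]

theorem orderInvariant_totalScore (σ : Equiv.Perm (ReducedWord D r) →
    Strategy (Equiv.Perm (ReducedWord D r))) (p : ℝ) (θ : Bool) :
    OrderInvariant fun T => condMean (branchGraph v) p σ T θ
      (fun z => if totalScore v θ (T v) T z ≤ 0 then 1 else 0) := by
  intro T T' h
  have h1 : ∀ z, totalScore v θ (T v) T z = totalScore v θ (T' v) T' z := fun z => by
    simp only [totalScore, h]
  simp only [h1]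
  exact orderInvariant_condMean _ p σ θ _ T T' h

/-- If the neighbours of `v` have on average a positive score, then `v` does well by following the
majority. -/
theorem integral_correct_majority_ge (hp : 0 ≤ p) (hp' : p ≤ 1) (hr : 0 < r) (hD : 0 < D)
    (θ : Bool) {m η : ℝ} (hm : 0 < m) (hη : 0 ≤ η) (hη' : η ≤ 1)
    (hmean : ∀ t : unitInterval, η ≤ t → (t : ℝ) ≤ 1 - η → ∀ i : Fin D,
      m ≤ ∫ T, (if T (step i * v) < t then (1 : ℝ) else 0) *
        meanScore (branchGraph v) p σ (step i * v) θ T) :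
    1 - (D : ℝ) ^ r / ((r + 1).factorial : ℝ) - 2 * η - 1 / (D * m ^ 2) ≤
      ∫ T, correct (wordGraph D r) p (Function.update σ v (majority v)) v T θ := by
  set W : (Equiv.Perm (ReducedWord D r) → unitInterval) → ℝ := fun T =>
    condMean (branchGraph v) p σ T θ (fun z => if totalScore v θ (T v) T z ≤ 0 then 1 else 0)
    with hW
  have hWoi : OrderInvariant W := orderInvariant_totalScore v σ p θ
  have hW0 : ∀ T, 0 ≤ W T := fun T =>
    condMean_nonneg _ hp hp' σ T θ fun z => by split_ifs <;> norm_num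
  have hW1 : ∀ T, W T ≤ 1 := fun T =>
    (condMean_mono _ hp hp' σ T θ fun z => by split_ifs <;> norm_num).trans_eq
      (condMean_const _ p σ T θ 1)
  let lo : unitInterval := ⟨η, hη, hη'⟩
  let hi : unitInterval := ⟨1 - η, by linarith, by linarith⟩
  let I : unitInterval → ℝ := fun t => if lo ≤ t ∧ t ≤ hi then 1 else 0
  have hIm : Measurable I := Measurable.ite measurableSet_Icc measurable_const measurable_const
  have hI0 : ∀ t, 0 ≤ I t := fun t => by simp only [I]; split_ifs <;> norm_num
  have hI1 : ∀ t, I t ≤ 1 := fun t => by simp only [I]; split_ifs <;> norm_num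
  have hIWm : Measurable fun T => I (T v) * W T :=
    (hIm.comp (measurable_pi_apply v)).mul hWoi.measurable
  have hIWb : ∀ T, |I (T v) * W T| ≤ 1 := fun T => by
    rw [abs_of_nonneg (mul_nonneg (hI0 _) (hW0 T))]
    exact mul_le_one₀ (hI1 _) (hW0 T) (hW1 T)
  have hIWi : Integrable fun T => I (T v) * W T := integrable_of_abs_le hIWm hIWb
  have hIW : ∫ T, I (T v) * W T ≤ 1 / (D * m ^ 2) := by
    -- Fix the arrival time `t` of `v` and integrate over the others first; Chebyshev's bound
    -- applies for each `t` in the range selected by `I`.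
    rw [integral_eq_integral_update' v hIWm hIWb]
    have hb : ∀ t : unitInterval, ∫ T, I (Function.update T v t v) * W (Function.update T v t) ≤
        1 / (D * m ^ 2) := by
      intro t
      simp only [Function.update_self]
      rw [integral_const_mul]
      by_cases ht : lo ≤ t ∧ t ≤ hi
      · have hWt : ∀ T, W (Function.update T v t) = condMean (branchGraph v) p σ T θ
            (fun z => if totalScore v θ t T z ≤ 0 then 1 else 0) := fun T => by
          have e : ∀ z, totalScore v θ t (Function.update T v t) z = totalScore v θ t T z :=
            fun z => by simp only [totalScore, Function.update_of_ne (step_mul_ne v hr _)]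
          simp only [hW, Function.update_self, e]
          rw [condMean_branchGraph_update]
        simp only [I, if_pos ht, one_mul, hWt]
        exact integral_totalScore_nonpos_le v σ θ hp hp' hr hD t hm (hmean t ht.1 ht.2)
      · simp only [I, if_neg ht, zero_mul]
        positivity
    refine (integral_mono_of_nonneg (ae_of_all _ fun t => ?_) (integrable_const _)
      (ae_of_all _ hb)).trans_eq (by simp)
    exact integral_nonneg fun T => mul_nonneg (hI0 _) (hW0 _)
  set B : Set (Equiv.Perm (ReducedWord D r) → unitInterval) := {T | HasLongDescent v T} with hB
  have hBm : MeasurableSet B := measurableSet_hasLongDescent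
  have hBi : Integrable (B.indicator fun _ => (1 : ℝ)) := (integrable_const _).indicator hBm
  have hlom : Measurable fun t : unitInterval => if t < lo then (1 : ℝ) else 0 :=
    Measurable.ite measurableSet_Iio measurable_const measurable_const
  have hhim : Measurable fun t : unitInterval => if hi < t then (1 : ℝ) else 0 :=
    Measurable.ite measurableSet_Ioi measurable_const measurable_const
  have hloi : Integrable fun T : Equiv.Perm (ReducedWord D r) → unitInterval =>
      if T v < lo then (1 : ℝ) else 0 :=
    integrable_of_abs_le (c := 1) (hlom.comp (measurable_pi_apply v)) fun T => by
      split_ifs <;> simp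
  have hhii : Integrable fun T : Equiv.Perm (ReducedWord D r) → unitInterval =>
      if hi < T v then (1 : ℝ) else 0 :=
    integrable_of_abs_le (c := 1) (hhim.comp (measurable_pi_apply v)) fun T => by
      split_ifs <;> simp
  -- Union bound: failure is charged to a long descent, to `v` arriving within `η` of either end, or
  -- to a nonpositive total score.
  have hpt : ∀ T, 1 ≤ correct (wordGraph D r) p (Function.update σ v (majority v)) v T θ +
      (B.indicator (fun _ => (1 : ℝ)) T + ((if T v < lo then (1 : ℝ) else 0) +
        ((if hi < T v then (1 : ℝ) else 0) + I (T v) * W T))) := by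
    intro T
    have h0 := correct_nonneg (wordGraph D r) hp hp' (Function.update σ v (majority v)) v T θ
    have h1 : 0 ≤ B.indicator (fun _ => (1 : ℝ)) T :=
      Set.indicator_nonneg (fun _ _ => zero_le_one) T
    have h2 : (0 : ℝ) ≤ if T v < lo then (1 : ℝ) else 0 := by split_ifs <;> norm_num
    have h3 : (0 : ℝ) ≤ if hi < T v then (1 : ℝ) else 0 := by split_ifs <;> norm_num
    have h4 : 0 ≤ I (T v) * W T := mul_nonneg (hI0 _) (hW0 T)
    by_cases hTB : T ∈ B
    · rw [Set.indicator_of_mem hTB]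
      linarith
    · by_cases hl : T v < lo
      · rw [if_pos hl]; linarith
      · by_cases hh : hi < T v
        · rw [if_pos hh]; linarith
        · have h5 : I (T v) = 1 := if_pos ⟨not_lt.1 hl, not_lt.1 hh⟩
          have h6 := correct_majority_ge v (σ := σ) hp hp' hr hTB θ
          rw [h5, one_mul] at h4 ⊢
          change 1 - W T ≤ _ at h6
          linarith
  have hcor := (orderInvariant_correct (wordGraph D r) p
    (Function.update σ v (majority v)) v θ).integrable
  have hR3 : Integrable fun T => (if hi < T v then (1 : ℝ) else 0) + I (T v) * W T :=
    hhii.add hIWi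
  have hR2 : Integrable fun T => (if T v < lo then (1 : ℝ) else 0) +
      ((if hi < T v then (1 : ℝ) else 0) + I (T v) * W T) := hloi.add hR3
  have hR1 : Integrable fun T => B.indicator (fun _ => (1 : ℝ)) T +
      ((if T v < lo then (1 : ℝ) else 0) +
      ((if hi < T v then (1 : ℝ) else 0) + I (T v) * W T)) := hBi.add hR2
  have hfin := integral_mono (integrable_const (1 : ℝ)) (hcor.add hR1) hpt
  simp only [integral_const, probReal_univ, smul_eq_mul, mul_one, Pi.add_apply] at hfin
  rw [integral_add hcor hR1, integral_add hBi hR2, integral_add hloi hR3, integral_add hhii hIWi,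
    integral_indicator_const _ hBm, integral_coord v hlom, integral_coord v hhim,
    integral_ite_lt, integral_ite_gt, smul_eq_mul, mul_one] at hfin
  have hBv : volume.real B ≤ (D : ℝ) ^ r / ((r + 1).factorial : ℝ) :=
    measureReal_hasLongDescent_le
  have e1 : (lo : ℝ) = η := rfl
  have e2 : (hi : ℝ) = 1 - η := rfl
  rw [e1, e2] at hfin
  linarith

theorem IsEquilibrium.learningQuality_ge (hp : 1 / 2 ≤ p) (hp' : p ≤ 1) (hr : 0 < r)
    (hD : 0 < D) (h : IsEquilibrium (wordGraph D r) p σ)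
    (hs : IsStateSymmetric (wordGraph D r) p σ) {m η κ : ℝ} (hm : 0 < m) (hη : 0 < η)
    (hη' : η ≤ 1) (hκ : 0 < κ)
    (hmη : m ≤ (2 * p - 1) * η - 2 * κ - 2 * ((D : ℝ) ^ r / ((r + 1).factorial : ℝ)) / η -
      2 * (1 / (κ * η) + 1 / η ^ 2) / √D) :
    1 - (D : ℝ) ^ r / ((r + 1).factorial : ℝ) - 2 * η - 1 / (D * m ^ 2) ≤
      learningQuality (wordGraph D r) p σ v := by
  have hp0 : 0 ≤ p := by linarith
  have key : ∀ θ, 1 - (D : ℝ) ^ r / ((r + 1).factorial : ℝ) - 2 * η - 1 / (D * m ^ 2) ≤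
      ∫ T, correct (wordGraph D r) p (Function.update σ v (majority v)) v T θ := fun θ =>
    integral_correct_majority_ge v hp0 hp' hr hD θ hm hη.le hη' fun t ht ht' i => by
      refine le_trans ?_ (h.integral_meanScore_ge v hp hp' hr hD hs θ i hη hκ ht')
      have : (2 * p - 1) * η ≤ (2 * p - 1) * t := mul_le_mul_of_nonneg_left ht (by linarith)
      linarith
  refine le_trans ?_ (h.update_le v (majority v))
  rw [learningQuality_eq _ hp0 hp', integral_const_mul,
    integral_add (orderInvariant_correct _ _ _ _ _).integrable
      (orderInvariant_correct _ _ _ _ _).integrable]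
  linarith [key true, key false]

end Majority

end SocialLearning

/-! ### Choice of the parameters. -/

open Filter Topology in
theorem theorem2 (p₀ δ : ℝ) (hp₀ : 1 / 2 < p₀) (hδ : 0 < δ) :
    ∃ (V : Type) (_ : Fintype V) (_ : Nonempty V) (G : SimpleGraph V),
      SocialLearning.IsSymmetricNetwork G ∧
        ∀ p : ℝ, p₀ < p → p ≤ 1 →
          ∀ σ : V → SocialLearning.Strategy V,
            SocialLearning.IsEquilibrium G p σ → SocialLearning.IsStateSymmetric G p σ →
              ∀ v : V, 1 - δ ≤ SocialLearning.learningQuality G p σ v := by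
  classical
  set ε : ℝ := 2 * p₀ - 1 with hε
  have hε0 : 0 < ε := by linarith
  set η : ℝ := min 1 (δ / 8) with hη
  have hη0 : 0 < η := lt_min one_pos (by linarith)
  have hη1 : η ≤ 1 := min_le_left _ _
  have hηδ : η ≤ δ / 8 := min_le_right _ _
  -- The mean score bound `ε * η` loses `2 * κ` to the smoothing window and `κ` each to long
  -- descents and to the time estimate, which leaves `ε * η / 2 = m`.
  set κ : ℝ := ε * η / 8 with hκ
  have hκ0 : 0 < κ := by positivity
  set L : ℝ := 2 * (1 / (κ * η) + 1 / η ^ 2) with hL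
  set m : ℝ := ε * η / 2 with hm
  have hm0 : 0 < m := by positivity
  obtain ⟨D, hD, hD1, hD2⟩ : ∃ D : ℕ, 0 < D ∧ L / √D ≤ κ ∧ 1 / (D * m ^ 2) ≤ δ / 4 := by
    have hcast : Tendsto (fun D : ℕ => (D : ℝ)) atTop atTop := tendsto_natCast_atTop_atTop
    have h1 : Tendsto (fun D : ℕ => L / √(D : ℝ)) atTop (𝓝 0) :=
      (Real.tendsto_sqrt_atTop.comp hcast).const_div_atTop L
    have h2 : Tendsto (fun D : ℕ => 1 / ((D : ℝ) * m ^ 2)) atTop (𝓝 0) :=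
      (hcast.atTop_mul_const (by positivity)).const_div_atTop 1
    obtain ⟨D, hD⟩ := ((eventually_gt_atTop 0).and ((h1.eventually_le_const hκ0).and
      (h2.eventually_le_const (show 0 < δ / 4 by positivity)))).exists
    exact ⟨D, hD⟩
  -- The radius is chosen after the degree: the factorial beats `D ^ r` only for fixed `D`, while
  -- the bounds on `D` do not involve `r`. The three losses `δ / 4`, `2 * η ≤ δ / 4` and `δ / 4`
  -- stay below `δ`.
  obtain ⟨r, hr, hr1, hr2⟩ : ∃ r : ℕ, 0 < r ∧
      2 * ((D : ℝ) ^ r / ((r + 1).factorial : ℝ)) / η ≤ κ ∧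
      (D : ℝ) ^ r / ((r + 1).factorial : ℝ) ≤ δ / 4 := by
    have h0 := FloorSemiring.tendsto_pow_div_factorial_atTop (D : ℝ)
    have h1 : Tendsto (fun r : ℕ => (D : ℝ) ^ r / ((r + 1).factorial : ℝ)) atTop (𝓝 0) :=
      squeeze_zero (fun r => by positivity) (fun r => by
        gcongr
        exact Nat.le_succ r) h0
    have h2 : Tendsto (fun r : ℕ => 2 * ((D : ℝ) ^ r / ((r + 1).factorial : ℝ)) / η) atTop
        (𝓝 0) := by
      simpa using (h1.const_mul 2).div_const η
    obtain ⟨r, hr⟩ := ((eventually_gt_atTop 0).and ((h2.eventually_le_const hκ0).and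
      (h1.eventually_le_const (show 0 < δ / 4 by positivity)))).exists
    exact ⟨r, hr⟩
  refine ⟨Equiv.Perm (SocialLearning.ReducedWord D r), Fintype.ofFinite _, ⟨1⟩,
    SocialLearning.wordGraph D r, SocialLearning.isSymmetricNetwork_wordGraph D r, ?_⟩
  intro p hp hp' σ h hs v
  let _ : Fintype (Equiv.Perm (SocialLearning.ReducedWord D r)) := Fintype.ofFinite _
  have hεη : ε * η ≤ (2 * p - 1) * η := mul_le_mul_of_nonneg_right (by linarith) hη0.le
  have key := h.learningQuality_ge v (by linarith) hp' hr hD hs hm0 hη0 hη1 hκ0 (by linarith)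
  linarith
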